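/- Let $d\in\mathbb{N}$, let $\Omega^-,\Omega^+\subseteq\mathbb{R}^d$ be open convex sets, and let $c\in\mathscr{C}^{1,1}_{\mathrm{loc}}(\Omega^-\times\Omega^+)$, i.e. $c$ is a real-valued differentiable function on $\Omega^-\times\Omega^+$ with locally Lipschitz gradient. Let $\mu^-,\mu^+$ be Borel probability measures on $\mathbb{R}^d$ that are absolutely continuous with respect to Lebesgue measure with densities in $L^\infty$, and whose supports are compact subsets of $\Omega^-$ and $\Omega^+$ respectively. Let $\Pi(\mu^-,\mu^+)$ be the set of couplings of $\mu^-$ and $\mu^+$, that is, of probability measures on $\mathbb{R}^d\times\mathbb{R}^d$ with marginals $\mu^-$ and $\mu^+$. Set $$v_0=\inf_{\gamma\in\Pi(\mu^-,\mu^+)}\int c\,\mathrm{d}\gamma,\qquad v_\varepsilon=\inf_{\gamma\in\Pi(\mu^-,\mu^+)}\Big\{\int c\,\mathrm{d}\gamma+\varepsilon\,\mathrm{Ent}(\gamma\,|\,\mu^-\otimes\mu^+)\Big\}\quad(\varepsilon>0),$$ where $\mathrm{Ent}(p\,|\,q)=\int\rho\log\rho\,\mathrm{d}q$ if $p=\rho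 q$, and $\mathrm{Ent}(p\,|\,q)=+\infty$ if $p$ is not absolutely continuous with respect to $q$. Then there exists a constant $M\ge 0$ such that for every $\varepsilon\in(0,1)$, $$v_\varepsilon\le v_0+\frac d2\,\varepsilon\log(1/\varepsilon)+M\varepsilon .$$ -/

import Mathlib

open MeasureTheory
open scoped ENNReal

noncomputable section

/-- A coupling of `μ` and `ν`: a probability measure on the product whose marginals are `μ` and
`ν`. -/
def IsCoupling {X Y : Type*} [MeasurableSpace X] [MeasurableSpace Y]
    (μ : Measure X) (ν : Measure Y) (γ : Measure (X × Y)) : Prop :=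
  IsProbabilityMeasure γ ∧ γ.map Prod.fst = μ ∧ γ.map Prod.snd = ν

/-- The optimal transport cost `v₀ = inf_γ ∫ c dγ`, the infimum being over all couplings. -/
def transportCost {X Y : Type*} [MeasurableSpace X] [MeasurableSpace Y]
    (c : X × Y → ℝ) (μ : Measure X) (ν : Measure Y) : EReal :=
  ⨅ (γ : Measure (X × Y)) (_ : IsCoupling μ ν γ), ((∫ z, c z ∂γ : ℝ) : EReal)

/-- The entropic optimal transport cost
`v_ε = inf_γ (∫ c dγ + ε Ent(γ | μ ⊗ ν))`, the infimum being over all couplings. The relative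
entropy is Mathlib's Kullback-Leibler divergence, which between probability measures is
`∫ ρ log ρ d(μ ⊗ ν)` when `γ = ρ (μ ⊗ ν)` (`∞` if this integral diverges), and `∞` otherwise. -/
def entropicCost {X Y : Type*} [MeasurableSpace X] [MeasurableSpace Y]
    (c : X × Y → ℝ) (μ : Measure X) (ν : Measure Y) (ε : ℝ) : EReal :=
  ⨅ (γ : Measure (X × Y)) (_ : IsCoupling μ ν γ),
    ((∫ z, c z ∂γ : ℝ) : EReal) +
      (ε : EReal) * ((InformationTheory.klDiv γ (μ.prod ν) : ℝ≥0∞) : EReal)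

/-- `f` is of class `C^{1,1}_loc` on the (open) set `U`: differentiable with locally Lipschitz
derivative. -/
def IsC11LocOn {F : Type*} [NormedAddCommGroup F] [NormedSpace ℝ F]
    (f : F → ℝ) (U : Set F) : Prop :=
  DifferentiableOn ℝ f U ∧ LocallyLipschitzOn U (fderiv ℝ f)

/-- `μ` is absolutely continuous with respect to the reference measure, with a density in
`L^∞`. -/
def HasBoundedDensity {X : Type*} [MeasureSpace X] (μ : Measure X) : Prop :=
  ∃ ρ : X → ℝ, MemLp ρ ∞ volume ∧ (∀ x, 0 ≤ ρ x) ∧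
    μ = volume.withDensity (fun x => ENNReal.ofReal (ρ x))

/-- `μ` is compactly supported in the set `U`. -/
def IsCompactlySupportedIn {X : Type*} [TopologicalSpace X] [MeasurableSpace X]
    (μ : Measure X) (U : Set X) : Prop :=
  IsCompact μ.support ∧ μ.support ⊆ U

end

/-! Fix the scale δ = √ε. Cut space into cells of side δ, solve the finite transport problem between
the cell masses with the cost evaluated at cell corners, and spread each entry of the plan as a
multiple of the product measure on the corresponding product of cells (`exists_block_coupling`). The
entropy of this coupling is at most the logarithm of the number of cells, of order δ^(-d), which
gives (d/2) log(1/ε) + O(1). It remains to show that its cost exceeds v₀ by only O(ε) = O(δ²); a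
Lipschitz cost alone would give O(δ).

By linear programming duality and two c-transforms, the discrete plan comes with Lipschitz
semiconcave potentials φ, ψ such that the gap E = c - φ - ψ is nonnegative everywhere and almost
zero, on average, at the corners charged by the plan. By weak duality ∫φ + ∫ψ ≤ v₀, so the excess
cost is at most ∫ E dγ. Since E ≥ 0 at the reflected point (x - h, y - h'), E(x + h, y + h') is at
most 2E(x, y) plus O(δ²) plus the negatives of the second differences of φ and ψ (`duality_gap_le`).

Semiconcavity does not bound these last terms pointwise by O(δ²), but it does on average: the second
differences are bounded above by O(δ²), and their sum over the grid telescopes to a boundary term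
controlled by the Lipschitz constant (`mul_sum_latticeBox_le`). Bounded densities transfer this from
a uniform sum over cells to the cell masses of the marginals (`sum_mul_cell_defect_le`). -/

/-! ### Globalizing the cost -/

open Topology in
/-- A locally Lipschitz map with compact support is Lipschitz. -/
theorem LocallyLipschitz.exists_norm_sub_le_of_hasCompactSupport {W G : Type*}
    [NormedAddCommGroup W] [ProperSpace W] [NormedAddCommGroup G]
    {F : W → G} (hF : LocallyLipschitz F) (hc : HasCompactSupport F) :
    ∃ K : ℝ, 0 ≤ K ∧ ∀ x y, ‖F x - F y‖ ≤ K * ‖x - y‖ := by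
  have hT : IsCompact (Metric.cthickening 1 (tsupport F)) := hc.isCompact.cthickening
  obtain ⟨K, hK⟩ := LocallyLipschitzOn.exists_lipschitzOnWith_of_compact hT
    (hF.locallyLipschitzOn (s := Metric.cthickening 1 (tsupport F)))
  obtain ⟨B, hB⟩ := hc.exists_bound_of_continuous hF.continuous
  -- Two regimes: inside the compact 1-neighbourhood of the support the local constants give `K`;
  -- outside it `F y = 0` and the points are at distance at least 1, so the sup bound `B` acts as a
  -- Lipschitz constant.
  have key : ∀ x y, x ∈ tsupport F → ‖F x - F y‖ ≤ max (K : ℝ) B * ‖x - y‖ := by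
    intro x y hx
    by_cases hy : y ∈ Metric.cthickening 1 (tsupport F)
    · refine (hK.norm_sub_le (Metric.self_subset_cthickening _ hx) hy).trans ?_
      gcongr
      exact le_max_left _ _
    · have hy0 : F y = 0 := image_eq_zero_of_notMem_tsupport fun h =>
        hy (Metric.self_subset_cthickening _ h)
      have hxy : 1 ≤ ‖x - y‖ := by
        by_contra! h
        refine hy (Metric.mem_cthickening_of_dist_le y x 1 _ hx ?_)
        rw [dist_comm, dist_eq_norm]
        exact h.le
      rw [hy0, sub_zero]
      have h0 : 0 ≤ max (K : ℝ) B := le_max_of_le_left K.2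
      calc ‖F x‖ ≤ max (K : ℝ) B * 1 := by rw [mul_one]; exact (hB x).trans (le_max_right _ _)
        _ ≤ _ := by gcongr
  refine ⟨max (K : ℝ) B, le_max_of_le_left K.2, fun x y => ?_⟩
  by_cases hx : x ∈ tsupport F
  · exact key x y hx
  by_cases hy : y ∈ tsupport F
  · rw [norm_sub_rev, norm_sub_rev x]
    exact key y x hy
  · rw [image_eq_zero_of_notMem_tsupport hx, image_eq_zero_of_notMem_tsupport hy, sub_zero,
      norm_zero]
    exact mul_nonneg (le_max_of_le_left K.2) (norm_nonneg _)

/-- Mean value inequality on the ball of radius `‖h‖` about `x`, where the derivative differs from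
its value at `x` by at most `K * ‖h‖`. The sharper factor 1/2 is not needed. -/
theorem norm_sub_sub_fderiv_le {W : Type*} [NormedAddCommGroup W] [NormedSpace ℝ W]
    {g : W → ℝ} (hg : Differentiable ℝ g) {K : ℝ} (hK0 : 0 ≤ K)
    (hK : ∀ x y, ‖fderiv ℝ g x - fderiv ℝ g y‖ ≤ K * ‖x - y‖) (x h : W) :
    |g (x + h) - g x - fderiv ℝ g x h| ≤ K * ‖h‖ ^ 2 := by
  have := (convex_closedBall x ‖h‖).norm_image_sub_le_of_norm_fderiv_le' (𝕜 := ℝ) (f := g)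
    (φ := fderiv ℝ g x) (C := K * ‖h‖) (x := x) (y := x + h) (fun y _ => hg y) (fun y hy => by
      refine (hK y x).trans ?_
      gcongr
      simpa [dist_eq_norm] using hy) (by simp) (by simp)
  simpa [pow_two, mul_assoc] using this

open Topology Manifold in
/-- A `C^{1,1}_loc` function on an open set agrees on a compact subset with a bounded, Lipschitz
function on the whole space whose first order Taylor remainder is uniformly quadratic. -/
theorem IsC11LocOn.exists_global_extension {W : Type*} [NormedAddCommGroup W] [NormedSpace ℝ W]
    [FiniteDimensional ℝ W] {f : W → ℝ} {U S : Set W} (hf : IsC11LocOn f U) (hU : IsOpen U)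
    (hS : IsCompact S) (hSU : S ⊆ U) :
    ∃ (g : W → ℝ) (ℓ : W → W →L[ℝ] ℝ) (B L K : ℝ), 0 ≤ L ∧ 0 ≤ K ∧ Continuous g ∧
      (∀ x ∈ S, g x = f x) ∧
      (∀ x, |g x| ≤ B) ∧ (∀ x y, |g x - g y| ≤ L * ‖x - y‖) ∧
      ∀ x h, |g (x + h) - g x - ℓ x h| ≤ K * ‖h‖ ^ 2 := by
  have : ProperSpace W := FiniteDimensional.proper ℝ W
  obtain ⟨T, hT, hST, hTU⟩ := exists_compact_between hS hU hSU
  -- Class C² makes the derivative of the cutoff itself locally Lipschitz, so that the product with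
  -- `f` stays of class C^{1,1}.
  obtain ⟨χ, hχ1, hχ0, -⟩ := exists_contMDiffMap_one_nhds_of_subset_interior (n := 2)
    𝓘(ℝ, W) hS.isClosed hST
  have hχ : ContDiff ℝ 2 (χ : W → ℝ) := χ.contMDiff.contDiff
  have hsupp : tsupport (χ : W → ℝ) ⊆ T := closure_minimal
    (fun x hx => by by_contra h; exact hx (hχ0 x h)) hT.isClosed
  set g : W → ℝ := fun x => χ x * f x with hg
  have hgT : tsupport g ⊆ T := (tsupport_mul_subset_left (f := χ) (g := f)).trans hsupp
  have hgc : HasCompactSupport g := HasCompactSupport.of_support_subset_isCompact hT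
    ((subset_tsupport g).trans hgT)
  have hout : ∀ x ∉ tsupport g, g =ᶠ[𝓝 x] 0 := fun x hx => notMem_tsupport_iff_eventuallyEq.mp hx
  have hdiffU : ∀ x ∈ U, HasFDerivAt g (χ x • fderiv ℝ f x + f x • fderiv ℝ χ x) x := fun x hx =>
    (hχ.differentiable (by simp) x).hasFDerivAt.mul
      (hf.1.differentiableAt (hU.mem_nhds hx)).hasFDerivAt
  have hgd : Differentiable ℝ g := by
    intro x
    by_cases hx : x ∈ U
    · exact (hdiffU x hx).differentiableAt
    · exact ((hout x fun h => hx (hTU (hgT h))).differentiableAt_iff).2 (differentiableAt_const 0)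
  have hlocU : LocallyLipschitz (U.domRestrict (fderiv ℝ g)) := by
    have h1 : LocallyLipschitz (U.domRestrict (fderiv ℝ f)) :=
      LocallyLipschitzOn.restrict hf.2
    have h2 : LocallyLipschitz (U.domRestrict f) := by
      refine LocallyLipschitzOn.restrict fun x hx => ?_
      have hcd : ContDiffOn ℝ 1 f U := by
        rw [← zero_add (1 : WithTop ℕ∞), contDiffOn_succ_iff_fderiv_of_isOpen hU]
        exact ⟨hf.1, by simp, contDiffOn_zero.2 hf.2.continuousOn⟩
      obtain ⟨K, t, ht, hK⟩ := ((hcd.contDiffAt (hU.mem_nhds hx))).exists_lipschitzOnWith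
      exact ⟨K, t, mem_nhdsWithin_of_mem_nhds ht, hK⟩
    have h3 : LocallyLipschitz (U.domRestrict χ) :=
      LocallyLipschitzOn.restrict
        ((hχ.of_le one_le_two).locallyLipschitz.locallyLipschitzOn)
    have h4 : LocallyLipschitz (U.domRestrict (fderiv ℝ χ)) :=
      LocallyLipschitzOn.restrict
        ((hχ.fderiv_right (m := 1) (by norm_num)).locallyLipschitz.locallyLipschitzOn)
    -- By the product rule the derivative of `g` on `U` is this C¹ map applied to four locally
    -- Lipschitz functions.
    have hΦ : ContDiff ℝ 1 (fun p : (ℝ × (W →L[ℝ] ℝ)) × (ℝ × (W →L[ℝ] ℝ)) =>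
        p.1.1 • p.1.2 + p.2.1 • p.2.2) := by fun_prop
    have := hΦ.locallyLipschitz.comp ((h3.prodMk h1).prodMk (h2.prodMk h4))
    convert this using 1
    ext1 x
    exact (hdiffU x x.2).fderiv
  have hloc : LocallyLipschitz (fderiv ℝ g) := by
    intro x
    by_cases hx : x ∈ U
    · obtain ⟨K, t, ht, hK⟩ := hlocU ⟨x, hx⟩
      refine ⟨K, Subtype.val '' t, (hU.isOpenEmbedding_subtypeVal.image_mem_nhds).2 ht, ?_⟩
      rintro _ ⟨a, ha, rfl⟩ _ ⟨b, hb, rfl⟩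
      exact hK ha hb
    · have hx' : x ∉ tsupport g := fun h => hx (hTU (hgT h))
      refine ⟨0, (tsupport g)ᶜ, (isClosed_tsupport g).isOpen_compl.mem_nhds hx', ?_⟩
      intro a ha b hb
      rw [(hout a ha).fderiv_eq, (hout b hb).fderiv_eq]
      simp
  obtain ⟨K, hK0, hK⟩ := hloc.exists_norm_sub_le_of_hasCompactSupport (hgc.fderiv ℝ)
  have hgC1 : ContDiff ℝ 1 g := contDiff_one_iff_fderiv.2 ⟨hgd, hloc.continuous⟩
  obtain ⟨L, hL⟩ := hgC1.lipschitzWith_of_hasCompactSupport hgc (by simp)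
  obtain ⟨B, hB⟩ := hgc.exists_bound_of_continuous hgd.continuous
  refine ⟨g, fderiv ℝ g, B, L, K, L.2, hK0, hgd.continuous, fun x hx => ?_, hB,
    fun x y => hL.norm_sub_le x y, norm_sub_sub_fderiv_le hgd hK0 hK⟩
  simp [hg, hχ1.self_of_nhdsSet x hx]

/-! ### Finite linear programming duality -/

/-- The marginals and the cost of a finite transport plan, as a linear map. -/
def finiteTransportMap {I J : Type*} [Fintype I] [Fintype J] (c : I → J → ℝ) :
    (I × J → ℝ) →ₗ[ℝ] (I → ℝ) × (J → ℝ) × ℝ where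
  toFun g := (fun i => ∑ j, g (i, j), fun j => ∑ i, g (i, j), ∑ p, g p * c p.1 p.2)
  map_add' g h := by
    ext <;> simp [Finset.sum_add_distrib, add_mul]
  map_smul' r g := by
    ext <;> simp [Finset.mul_sum, mul_assoc]

/-- Approximate linear programming duality for the finite optimal transport problem: there are a
plan and a pair of dual feasible potentials with arbitrarily small duality gap. -/
theorem exists_finite_plan_potentials {I J : Type*} [Fintype I] [Fintype J]
    {a : I → ℝ} {b : J → ℝ} (ha : ∀ i, 0 ≤ a i) (hb : ∀ j, 0 ≤ b j)
    (ha1 : ∑ i, a i = 1) (hb1 : ∑ j, b j = 1) (c : I → J → ℝ) {η : ℝ} (hη : 0 < η) :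
    ∃ (g : I → J → ℝ) (φ : I → ℝ) (ψ : J → ℝ), (∀ i j, 0 ≤ g i j) ∧
      (∀ i, ∑ j, g i j = a i) ∧ (∀ j, ∑ i, g i j = b j) ∧ (∀ i j, φ i + ψ j ≤ c i j) ∧
      ∑ p : I × J, g p.1 p.2 * (c p.1 p.2 - φ p.1 - ψ p.2) ≤ η := by
  classical
  set Φ := finiteTransportMap c with hΦ
  have hΦc : Continuous Φ := Φ.continuous_of_finiteDimensional
  -- The marginal constraints already force total mass 1; imposing it from the start makes the image
  -- of `S` compact, as strict separation requires.
  set S : Set (I × J → ℝ) := stdSimplex ℝ (I × J) with hS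
  set P : Set ℝ := {t | ∃ g ∈ S, Φ g = (a, b, t)} with hP
  have hprod : (fun p : I × J => a p.1 * b p.2) ∈ S :=
    ⟨fun p => mul_nonneg (ha _) (hb _), by
      rw [Fintype.sum_prod_type]
      simp [← Finset.mul_sum, hb1, ha1]⟩
  have hΦprod : Φ (fun p : I × J => a p.1 * b p.2) =
      (a, b, ∑ p : I × J, a p.1 * b p.2 * c p.1 p.2) := by
    ext <;> simp [hΦ, finiteTransportMap, ← Finset.mul_sum, ← Finset.sum_mul, ha1, hb1]
  have hPne : P.Nonempty := ⟨_, _, hprod, hΦprod⟩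
  have hPbdd : BddBelow P := by
    obtain ⟨m, hm⟩ := ((isCompact_stdSimplex ℝ (I × J)).image hΦc).image
      (continuous_snd.comp continuous_snd) |>.bddBelow
    refine ⟨m, ?_⟩
    rintro t ⟨g, hg, hgt⟩
    exact hm ⟨Φ g, ⟨g, hg, rfl⟩, by simp [hgt]⟩
  set v := sInf P
  obtain ⟨t, ⟨g, hgS, hgt⟩, htv⟩ := exists_lt_of_csInf_lt hPne
    (show sInf P < v + η / 2 from lt_add_of_pos_right _ (half_pos hη))
  -- No plan with marginals `a`, `b` costs less than `v`, so lowering the level by `η / 2` leaves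
  -- strict room for Hahn-Banach.
  have hdisj : Disjoint (Φ '' S) ({a} ×ˢ ({b} ×ˢ Set.Iic (v - η / 2))) := by
    rw [Set.disjoint_left]
    rintro _ ⟨h, hh, rfl⟩ ⟨h1, h2, h3⟩
    simp only [Set.mem_singleton_iff, Set.mem_Iic] at h1 h2 h3
    have := csInf_le hPbdd (show (Φ h).2.2 ∈ P from ⟨h, hh, by rw [← h1, ← h2]⟩)
    linarith [half_pos hη]
  obtain ⟨f, u, w, hfu, huw, hwf⟩ := geometric_hahn_banach_compact_closed
    ((convex_stdSimplex ℝ (I × J)).linear_image Φ) ((isCompact_stdSimplex ℝ (I × J)).image hΦc)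
    ((convex_singleton a).prod ((convex_singleton b).prod (convex_Iic (v - η / 2))))
    (isClosed_singleton.prod (isClosed_singleton.prod isClosed_Iic)) hdisj
  set τ := f (0, 0, 1) with hτ
  set A := f (a, b, 0) with hA
  have hfab : ∀ s, f (a, b, s) = A + s * τ := fun s => by
    rw [hA, hτ, ← smul_eq_mul, ← map_smul, ← map_add]
    simp
  have hT : ∀ s ≤ v - η / 2, w < A + s * τ := fun s hs => by
    rw [← hfab]
    exact hwf _ ⟨rfl, rfl, hs⟩
  -- The separating hyperplane is not vertical: the product plan has the right marginals, so `τ = 0`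
  -- fails, and `τ > 0` fails because the second set contains arbitrarily low costs.
  have hτ0 : τ < 0 := by
    have h1 := hfu _ ⟨_, hprod, rfl⟩
    rw [hΦprod, hfab] at h1
    by_contra! h0
    rcases h0.eq_or_lt with h0 | h0
    · have := hT (v - η / 2) le_rfl
      rw [← h0] at this h1
      linarith
    · have := hT (min (v - η / 2) (∑ p : I × J, a p.1 * b p.2 * c p.1 p.2)) (min_le_left _ _)
      have h2 := mul_le_mul_of_nonneg_right (min_le_right (v - η / 2)
        (∑ p : I × J, a p.1 * b p.2 * c p.1 p.2)) h0.le
      linarith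
  set p : I → ℝ := fun i => f (Pi.single i 1, 0, 0)
  set q : J → ℝ := fun j => f (0, Pi.single j 1, 0)
  have hΦs : ∀ i j, f (Φ (Pi.single (i, j) 1)) = p i + q j + c i j * τ := by
    intro i j
    have : Φ (Pi.single (i, j) 1) = (Pi.single i 1, Pi.single j 1, c i j) := by
      refine Prod.ext (funext fun k => ?_) (Prod.ext (funext fun k => ?_) ?_)
      · simp [hΦ, finiteTransportMap, Pi.single_apply, Prod.ext_iff, ite_and]
      · simp [hΦ, finiteTransportMap, Pi.single_apply, Prod.ext_iff, ite_and]
      · simp [hΦ, finiteTransportMap, Pi.single_apply]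
    rw [this, hτ, ← smul_eq_mul (c i j), ← map_smul, ← map_add, ← map_add]
    simp
  have hfeas : ∀ i j, p i + q j + c i j * τ < A + (v - η / 2) * τ := fun i j => by
    rw [← hΦs]
    exact ((hfu _ ⟨_, single_mem_stdSimplex ℝ (i, j), rfl⟩).trans huw).trans (hT _ le_rfl)
  have hsum : ∑ r : I × J, g r * (p r.1 + q r.2 + c r.1 r.2 * τ) = A + t * τ := by
    rw [← hfab, ← hgt]
    have := LinearMap.pi_apply_eq_sum_univ (f.toLinearMap ∘ₗ Φ) g
    simp only [LinearMap.comp_apply, ContinuousLinearMap.coe_coe, smul_eq_mul] at this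
    rw [this]
    refine Finset.sum_congr rfl fun r _ => ?_
    have hr : (Pi.single r 1 : I × J → ℝ) = fun j => if r = j then 1 else 0 := by
      ext j
      simp [Pi.single_apply, eq_comm]
    rw [← hΦs, Prod.mk.eta, hr]
  -- Dividing by `-τ` turns separation at unit masses into dual feasibility. The additive constant,
  -- which total mass 1 makes harmless, sets the dual value to `v - η / 2`; as the plan costs `t < v
  -- + η / 2`, the gap is below `η`.
  refine ⟨fun i j => g (i, j), fun i => (p i - A) / (-τ) + (v - η / 2), fun j => q j / (-τ),
    fun i j => hgS.1 _, fun i => congrFun (congrArg Prod.fst hgt) i,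
    fun j => congrFun (congrArg (fun z => z.2.1) hgt) j, fun i j => ?_, ?_⟩
  · have h := hfeas i j
    have h0 : 0 < -τ := by linarith
    have h3 : (p i - A) / (-τ) + (v - η / 2) + q j / (-τ) =
        (p i + q j - A - (v - η / 2) * τ) / (-τ) := by
      field_simp [hτ0.ne]
      ring
    rw [h3, div_le_iff₀ h0]
    linarith
  · have h3 : ∀ r : I × J, g r * (c r.1 r.2 - ((p r.1 - A) / (-τ) + (v - η / 2)) - q r.2 / (-τ)) =
        g r * (p r.1 + q r.2 + c r.1 r.2 * τ) / τ - g r * (A / τ + (v - η / 2)) := by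
      intro r
      field_simp [hτ0.ne]
      ring
    simp only [Prod.mk.eta, h3]
    rw [Finset.sum_sub_distrib, ← Finset.sum_div, ← Finset.sum_mul, hsum, hgS.2]
    have h4 : (A + t * τ) / τ - 1 * (A / τ + (v - η / 2)) = t - v + η / 2 := by
      field_simp [hτ0.ne]
      ring
    rw [h4]
    linarith

/-! ### Block approximation and its entropy -/

theorem integrable_comp_of_finite {Z I : Type*} [MeasurableSpace Z] [Finite I]
    [MeasurableSpace I] [MeasurableSingletonClass I] (m : Measure Z) [IsFiniteMeasure m]
    {κ : Z → I} (hκ : Measurable κ) (F : I → ℝ) : Integrable (fun z => F (κ z)) m :=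
  (Integrable.of_finite (μ := m.map κ) (f := F)).comp_measurable hκ

theorem integral_comp_fintype {Z I : Type*} [MeasurableSpace Z] [Fintype I]
    [MeasurableSpace I] [MeasurableSingletonClass I] (m : Measure Z) [IsFiniteMeasure m]
    {κ : Z → I} (hκ : Measurable κ) (F : I → ℝ) :
    ∫ z, F (κ z) ∂m = ∑ i, m.real (κ ⁻¹' {i}) * F i := by
  rw [← integral_map (μ := m) hκ.aemeasurable (f := F)
    (measurable_of_finite F).aestronglyMeasurable, integral_fintype .of_finite]
  refine Finset.sum_congr rfl fun i _ => ?_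
  rw [map_measureReal_apply hκ (measurableSet_singleton i), smul_eq_mul]

theorem lintegral_comp_fintype {Z I : Type*} [MeasurableSpace Z] [Fintype I]
    [MeasurableSpace I] [MeasurableSingletonClass I] (m : Measure Z)
    {κ : Z → I} (hκ : Measurable κ) (F : I → ℝ≥0∞) :
    ∫⁻ z, F (κ z) ∂m = ∑ i, F i * m (κ ⁻¹' {i}) := by
  rw [← lintegral_map (measurable_of_finite F) hκ, lintegral_fintype]
  refine Finset.sum_congr rfl fun i _ => ?_
  rw [Measure.map_apply hκ (measurableSet_singleton i)]

/-- The null fibers form a finite union of null sets; hence divisions by block masses are legitimate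
almost everywhere. -/
theorem ae_measureReal_fiber_ne_zero {Z I : Type*} [MeasurableSpace Z] [Finite I]
    (m : Measure Z) [IsFiniteMeasure m] (κ : Z → I) :
    ∀ᵐ z ∂m, m.real (κ ⁻¹' {κ z}) ≠ 0 := by
  have : {z | ¬ m.real (κ ⁻¹' {κ z}) ≠ 0} = ⋃ i ∈ {i | m (κ ⁻¹' {i}) = 0}, κ ⁻¹' {i} := by
    ext z
    simp [measureReal_eq_zero_iff]
  rw [ae_iff, this]
  exact (measure_biUnion_null_iff (Set.to_countable _)).2 fun i hi => hi

/-- The Shannon entropy of a probability vector is at most the logarithm of its length. -/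
theorem sum_mul_neg_log_le_log_card {I : Type*} [Fintype I] {a : I → ℝ} (ha : ∀ i, 0 ≤ a i)
    (ha1 : ∑ i, a i = 1) : ∑ i, a i * -Real.log (a i) ≤ Real.log (Fintype.card I) := by
  have : Nonempty I := by
    by_contra h
    rw [not_nonempty_iff] at h
    simp at ha1
  set n : ℝ := (Fintype.card I : ℝ) with hn
  have hn0 : 0 < n := Nat.cast_pos.2 Fintype.card_pos
  -- Gibbs' inequality: `log t ≤ t - 1` at `t = 1 / (a i * n)`.
  have key : ∀ i, a i * -Real.log (a i) ≤ a i * Real.log n + 1 / n - a i := by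
    intro i
    rcases (ha i).eq_or_lt with h | h
    · rw [← h]
      simp [hn0.le]
    · have h1 := Real.log_le_sub_one_of_pos (show 0 < 1 / (a i * n) by positivity)
      rw [one_div, Real.log_inv, Real.log_mul h.ne' hn0.ne'] at h1
      have h2 := mul_le_mul_of_nonneg_left h1 h.le
      have h3 : a i * ((a i * n)⁻¹ - 1) = 1 / n - a i := by
        field_simp
      rw [h3] at h2
      linarith
  refine (Finset.sum_le_sum fun i _ => key i).trans ?_
  rw [Finset.sum_sub_distrib, Finset.sum_add_distrib, ← Finset.sum_mul, ha1]
  simp only [Finset.sum_const, Finset.card_univ, nsmul_eq_mul, one_mul]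
  rw [← hn, mul_one_div_cancel hn0.ne']
  linarith

/-- The block approximation: a finite transport plan between the images of `μ` and `ν` under
finitely valued maps lifts to a coupling of `μ` and `ν` of entropy at most the logarithm of the
number of blocks. -/
theorem exists_block_coupling {X Y I J : Type*} [MeasurableSpace X] [MeasurableSpace Y]
    [Fintype I] [Fintype J] [MeasurableSpace I] [MeasurableSingletonClass I]
    [MeasurableSpace J] [MeasurableSingletonClass J]
    (μ : Measure X) (ν : Measure Y) [IsProbabilityMeasure μ] [IsProbabilityMeasure ν]
    {κ : X → I} {l : Y → J} (hκ : Measurable κ) (hl : Measurable l)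
    {g : I → J → ℝ} (hg : ∀ i j, 0 ≤ g i j) (hg1 : ∀ i, ∑ j, g i j = μ.real (κ ⁻¹' {i}))
    (hg2 : ∀ j, ∑ i, g i j = ν.real (l ⁻¹' {j})) :
    ∃ γ : Measure (X × Y), IsCoupling μ ν γ ∧
      (∀ p : I × J, γ.real (Prod.map κ l ⁻¹' {p}) = g p.1 p.2) ∧
      InformationTheory.klDiv γ (μ.prod ν) ≤ ENNReal.ofReal (Real.log (Fintype.card I)) := by
  set a : I → ℝ := fun i => μ.real (κ ⁻¹' {i}) with ha
  set b : J → ℝ := fun j => ν.real (l ⁻¹' {j}) with hb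
  replace hg1 : ∀ i, ∑ j, g i j = a i := hg1
  replace hg2 : ∀ j, ∑ i, g i j = b j := hg2
  have hga : ∀ i j, g i j ≤ a i := fun i j => by
    rw [← hg1]
    exact Finset.single_le_sum (f := fun j => g i j) (fun j _ => hg i j) (Finset.mem_univ j)
  have hgb : ∀ i j, g i j ≤ b j := fun i j => by
    rw [← hg2]
    exact Finset.single_le_sum (f := fun i => g i j) (fun i _ => hg i j) (Finset.mem_univ i)
  have ha0 : ∀ i, 0 ≤ a i := fun i => measureReal_nonneg
  have hb0 : ∀ j, 0 ≤ b j := fun j => measureReal_nonneg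
  -- Density constant on products of blocks. Its value 0 on null blocks, from division by zero, is
  -- consistent, since `g` vanishes there.
  set r : I × J → ℝ := fun p => g p.1 p.2 / (a p.1 * b p.2) with hr
  have hr0 : ∀ p, 0 ≤ r p := fun p => div_nonneg (hg _ _) (mul_nonneg (ha0 _) (hb0 _))
  have hrb : ∀ i j, r (i, j) * b j = g i j / a i := by
    intro i j
    rcases eq_or_ne (b j) 0 with h | h
    · have : g i j = 0 := le_antisymm (h ▸ hgb i j) (hg i j)
      simp [hr, h, this]
    · simp only [hr]
      field_simp
  have hra : ∀ i j, r (i, j) * a i = g i j / b j := by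
    intro i j
    rcases eq_or_ne (a i) 0 with h | h
    · have : g i j = 0 := le_antisymm (h ▸ hga i j) (hg i j)
      simp [hr, h, this]
    · simp only [hr]
      field_simp
  have hrab : ∀ i j, r (i, j) * (a i * b j) = g i j := by
    intro i j
    rw [mul_comm (a i), ← mul_assoc, hrb]
    rcases eq_or_ne (a i) 0 with h | h
    · rw [h, mul_zero]
      exact le_antisymm (hg i j) (h ▸ hga i j)
    · field_simp
  have hp : Measurable (Prod.map κ l) := hκ.prodMap hl
  set ρ : X × Y → ℝ≥0∞ := fun z => ENNReal.ofReal (r (Prod.map κ l z)) with hρ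
  have hρm : Measurable ρ := (measurable_of_finite fun p => ENNReal.ofReal (r p)).comp hp
  set γ := (μ.prod ν).withDensity ρ with hγ
  have hfst : γ.map Prod.fst = μ := by
    ext s hs
    rw [Measure.map_apply measurable_fst hs, hγ, withDensity_apply _ (measurable_fst hs),
      ← Set.prod_univ, ← Measure.prod_restrict, lintegral_prod _ hρm.aemeasurable,
      Measure.restrict_univ]
    rw [← setLIntegral_one]
    refine lintegral_congr_ae (ae_restrict_of_ae ?_)
    filter_upwards [ae_measureReal_fiber_ne_zero μ κ] with x hx
    simp only [hρ, Prod.map_apply]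
    rw [lintegral_comp_fintype ν hl (fun j => ENNReal.ofReal (r (κ x, j)))]
    have : ∀ j, ENNReal.ofReal (r (κ x, j)) * ν (l ⁻¹' {j}) =
        ENNReal.ofReal (g (κ x) j / a (κ x)) := fun j => by
      rw [← hrb, ENNReal.ofReal_mul (hr0 _), hb]
      simp
    simp_rw [this]
    rw [← ENNReal.ofReal_sum_of_nonneg fun j _ => div_nonneg (hg _ _) (ha0 _), ← Finset.sum_div,
      hg1, div_self hx, ENNReal.ofReal_one]
  have hsnd : γ.map Prod.snd = ν := by
    ext s hs
    rw [Measure.map_apply measurable_snd hs, hγ, withDensity_apply _ (measurable_snd hs),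
      ← Set.univ_prod, ← Measure.prod_restrict, lintegral_prod_symm _ hρm.aemeasurable,
      Measure.restrict_univ]
    rw [← setLIntegral_one]
    refine lintegral_congr_ae (ae_restrict_of_ae ?_)
    filter_upwards [ae_measureReal_fiber_ne_zero ν l] with y hy
    simp only [hρ, Prod.map_apply]
    rw [lintegral_comp_fintype μ hκ (fun i => ENNReal.ofReal (r (i, l y)))]
    have : ∀ i, ENNReal.ofReal (r (i, l y)) * μ (κ ⁻¹' {i}) =
        ENNReal.ofReal (g i (l y) / b (l y)) := fun i => by
      rw [← hra, ENNReal.ofReal_mul (hr0 _), ha]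
      simp
    simp_rw [this]
    rw [← ENNReal.ofReal_sum_of_nonneg fun i _ => div_nonneg (hg _ _) (hb0 _), ← Finset.sum_div,
      hg2, div_self hy, ENNReal.ofReal_one]
  have hprob : IsProbabilityMeasure γ := by
    constructor
    have : γ.map Prod.fst Set.univ = 1 := by rw [hfst]; simp
    rwa [Measure.map_apply measurable_fst .univ] at this
  have hcell : ∀ p : I × J, γ.real (Prod.map κ l ⁻¹' {p}) = g p.1 p.2 := by
    intro p
    have hpre : Prod.map κ l ⁻¹' {p} = (κ ⁻¹' {p.1}) ×ˢ (l ⁻¹' {p.2}) := by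
      ext z
      simp [Prod.ext_iff]
    have hm := hp (measurableSet_singleton p)
    rw [measureReal_def, hγ, withDensity_apply _ hm,
      setLIntegral_congr_fun (g := fun _ => ENNReal.ofReal (r p)) hm
        (fun z hz => by simp only [hρ]; rw [show Prod.map κ l z = p from hz]),
      setLIntegral_const, hpre, Measure.prod_prod, ENNReal.toReal_mul, ENNReal.toReal_mul,
      ENNReal.toReal_ofReal (hr0 p)]
    exact hrab p.1 p.2
  refine ⟨γ, ⟨hprob, hfst, hsnd⟩, hcell, ?_⟩
  have hac : γ ≪ μ.prod ν := withDensity_absolutelyContinuous _ _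
  have hllr : llr γ (μ.prod ν) =ᵐ[γ] fun z => Real.log (r (Prod.map κ l z)) := by
    refine hac.ae_le ?_
    filter_upwards [Measure.rnDeriv_withDensity (μ.prod ν) hρm] with z hz
    rw [llr, hγ, hz, hρ, ENNReal.toReal_ofReal (hr0 _)]
  have hint := integrable_comp_of_finite γ hp fun p => Real.log (r p)
  rw [InformationTheory.klDiv_of_ac_of_integrable hac (hint.congr hllr.symm),
    integral_congr_ae hllr, integral_comp_fintype γ hp fun p => Real.log (r p)]
  simp only [probReal_univ, add_sub_cancel_right]
  refine ENNReal.ofReal_le_ofReal ?_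
  have hsa : ∑ i, a i = 1 := by
    have := integral_comp_fintype μ hκ fun _ => 1
    simpa using this.symm
  -- Since `g i j ≤ b j`, the density is at most `1 / a i` wherever `g i j > 0`, so the relative
  -- entropy is at most the Shannon entropy of `a`.
  refine le_trans ?_ (sum_mul_neg_log_le_log_card ha0 hsa)
  rw [Fintype.sum_prod_type]
  refine Finset.sum_le_sum fun i _ => ?_
  have hi : a i * -Real.log (a i) = ∑ j, g i j * -Real.log (a i) := by
    rw [← Finset.sum_mul, hg1]
  rw [hi]
  refine Finset.sum_le_sum fun j _ => ?_
  rw [hcell]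
  rcases (hg i j).eq_or_lt with h | h
  · simp [← h]
  refine mul_le_mul_of_nonneg_left ?_ h.le
  have h1 : 0 < a i := h.trans_le (hga i j)
  have h2 : 0 < b j := h.trans_le (hgb i j)
  change Real.log (g i j / (a i * b j)) ≤ -Real.log (a i)
  rw [← Real.log_inv]
  refine Real.log_le_log (by positivity) ?_
  rw [div_le_iff₀ (by positivity), ← mul_assoc, inv_mul_cancel₀ h1.ne', one_mul]
  exact hgb i j

/-! ### Semiconcave potentials -/

theorem abs_iInf_sub_iInf_le {V ι : Type*} [NormedAddCommGroup V] [Nonempty ι] {u : ι → V → ℝ} {L : ℝ}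
    (hu : ∀ i x y, |u i x - u i y| ≤ L * ‖x - y‖)
    (hb : ∀ x, BddBelow (Set.range fun i => u i x)) (x y : V) :
    |(⨅ i, u i x) - ⨅ i, u i y| ≤ L * ‖x - y‖ := by
  have key : ∀ x y, (⨅ i, u i x) - L * ‖x - y‖ ≤ ⨅ i, u i y := fun x y => by
    refine le_ciInf fun i => ?_
    have := (abs_le.1 (hu i x y)).2
    linarith [ciInf_le (hb x) i]
  have h1 := key x y
  have h2 := key y x
  rw [norm_sub_rev] at h2
  rw [abs_le]
  constructor <;> linarith

section Semiconcave

variable {V : Type*} [NormedAddCommGroup V] [InnerProductSpace ℝ V]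

/-- A function with uniformly quadratic first order Taylor remainder is semiconcave. -/
theorem convexOn_mul_norm_sq_sub_of_taylor {u : V → ℝ} {ℓ : V → V →L[ℝ] ℝ} {K : ℝ}
    (hu : ∀ x h, |u (x + h) - u x - ℓ x h| ≤ K * ‖h‖ ^ 2) :
    ConvexOn ℝ Set.univ fun x => K * ‖x‖ ^ 2 - u x := by
  refine ⟨convex_univ, fun x _ y _ a b ha hb hab => ?_⟩
  set z := a • x + b • y with hz
  -- The Taylor bound gives an affine minorant touching at `z`; its linear part cancels in the
  -- convex combination.
  have key : ∀ w, K * ‖z‖ ^ 2 - u z + (2 * K * inner ℝ z (w - z) - ℓ z (w - z)) ≤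
      K * ‖w‖ ^ 2 - u w := by
    intro w
    have h1 := (abs_le.1 (hu z (w - z))).2
    have h2 : ‖w‖ ^ 2 = ‖z‖ ^ 2 + 2 * inner ℝ z (w - z) + ‖w - z‖ ^ 2 := by
      rw [← norm_add_sq_real, add_sub_cancel]
    rw [add_sub_cancel] at h1
    rw [h2]
    linarith
  have hx := mul_le_mul_of_nonneg_left (key x) ha
  have hy := mul_le_mul_of_nonneg_left (key y) hb
  have h0 : a • (x - z) + b • (y - z) = 0 := by
    have : a • (x - z) + b • (y - z) = z - (a + b) • z := by
      rw [hz]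
      module
    rw [this, hab, one_smul, sub_self]
  have hi : a * inner ℝ z (x - z) + b * inner ℝ z (y - z) = 0 := by
    rw [← real_inner_smul_right, ← real_inner_smul_right, ← inner_add_right, h0, inner_zero_right]
  have hℓ : a * ℓ z (x - z) + b * ℓ z (y - z) = 0 := by
    rw [← smul_eq_mul, ← smul_eq_mul, ← map_smul, ← map_smul, ← map_add, h0, map_zero]
  have hab' : a * (K * ‖z‖ ^ 2 - u z) + b * (K * ‖z‖ ^ 2 - u z) = K * ‖z‖ ^ 2 - u z := by
    rw [← add_mul, hab, one_mul]
  simp only [smul_eq_mul]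
  have hi' : 2 * K * (a * inner ℝ z (x - z) + b * inner ℝ z (y - z)) = 0 := by rw [hi, mul_zero]
  linarith

/-- Subtracting an infimum gives a supremum of convex functions. -/
theorem convexOn_mul_norm_sq_sub_iInf {ι : Type*} [Nonempty ι] {u : ι → V → ℝ} {K : ℝ}
    (hu : ∀ i, ConvexOn ℝ Set.univ fun x => K * ‖x‖ ^ 2 - u i x)
    (hb : ∀ x, BddBelow (Set.range fun i => u i x)) :
    ConvexOn ℝ Set.univ fun x => K * ‖x‖ ^ 2 - ⨅ i, u i x := by
  refine ⟨convex_univ, fun x _ y _ a b ha hb' hab => ?_⟩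
  rw [sub_le_comm]
  refine le_ciInf fun i => ?_
  have h := (hu i).2 (Set.mem_univ x) (Set.mem_univ y) ha hb' hab
  have hx := mul_le_mul_of_nonneg_left (ciInf_le (hb x) i) ha
  have hy := mul_le_mul_of_nonneg_left (ciInf_le (hb y) i) hb'
  simp only [smul_eq_mul] at h ⊢
  linarith

/-- Finite dual feasible potentials extend to Lipschitz semiconcave ones on the whole space. -/
theorem exists_semiconcave_potentials {I J : Type*} [Finite J] [Nonempty J]
    {c : V × V → ℝ} {ℓ : V × V → V × V →L[ℝ] ℝ} {B L K : ℝ} (hB : ∀ z, |c z| ≤ B)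
    (hL : ∀ z w, |c z - c w| ≤ L * ‖z - w‖)
    (hK : ∀ z h, |c (z + h) - c z - ℓ z h| ≤ K * ‖h‖ ^ 2)
    (x : I → V) (y : J → V) {φ₀ : I → ℝ} {ψ₀ : J → ℝ}
    (h₀ : ∀ i j, φ₀ i + ψ₀ j ≤ c (x i, y j)) :
    ∃ φ ψ : V → ℝ, (∀ a b, |φ a - φ b| ≤ L * ‖a - b‖) ∧ (∀ a b, |ψ a - ψ b| ≤ L * ‖a - b‖) ∧
      (ConvexOn ℝ Set.univ fun a => K * ‖a‖ ^ 2 - φ a) ∧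
      (ConvexOn ℝ Set.univ fun a => K * ‖a‖ ^ 2 - ψ a) ∧
      (∀ a b, φ a + ψ b ≤ c (a, b)) ∧ (∀ i, φ₀ i ≤ φ (x i)) ∧ ∀ j, ψ₀ j ≤ ψ (y j) := by
  have hLl : ∀ b a a', |c (a, b) - c (a', b)| ≤ L * ‖a - a'‖ := fun b a a' => by
    simpa using hL (a, b) (a', b)
  have hLr : ∀ a b b', |c (a, b) - c (a, b')| ≤ L * ‖b - b'‖ := fun a b b' => by
    simpa using hL (a, b) (a, b')
  have hKl : ∀ (b : V) (s : ℝ), ConvexOn ℝ Set.univ fun a => K * ‖a‖ ^ 2 - (c (a, b) - s) :=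
    fun b s => convexOn_mul_norm_sq_sub_of_taylor
      (ℓ := fun a => (ℓ (a, b)).comp (ContinuousLinearMap.inl ℝ V V)) fun a h => by
        simpa using hK (a, b) (h, 0)
  have hKr : ∀ (a : V) (s : ℝ), ConvexOn ℝ Set.univ fun b => K * ‖b‖ ^ 2 - (c (a, b) - s) :=
    fun a s => convexOn_mul_norm_sq_sub_of_taylor
      (ℓ := fun b => (ℓ (a, b)).comp (ContinuousLinearMap.inr ℝ V V)) fun b h => by
        simpa using hK (a, b) (0, h)
  -- First c-transform over the finitely many points `y j`; the second runs over all of `V`, so that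
  -- feasibility holds everywhere. Neither lowers the given values.
  set φ : V → ℝ := fun a => ⨅ j, (c (a, y j) - ψ₀ j) with hφ
  have hφb : ∀ a, BddBelow (Set.range fun j => c (a, y j) - ψ₀ j) := fun a =>
    (Set.finite_range _).bddBelow
  obtain ⟨S, hS⟩ := (Set.finite_range ψ₀).bddBelow
  have hφS : ∀ a, φ a ≤ B - S := fun a => by
    refine (ciInf_le (hφb a) (Classical.arbitrary J)).trans ?_
    have := hS ⟨Classical.arbitrary J, rfl⟩
    linarith [(abs_le.1 (hB (a, y (Classical.arbitrary J)))).2]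
  have hψb : ∀ b, BddBelow (Set.range fun a => c (a, b) - φ a) := fun b => by
    refine ⟨-B - (B - S), ?_⟩
    rintro _ ⟨a, rfl⟩
    have h1 := (abs_le.1 (hB (a, b))).1
    have h2 := hφS a
    dsimp only
    linarith
  refine ⟨φ, fun b => ⨅ a, (c (a, b) - φ a),
    abs_iInf_sub_iInf_le (fun j a a' => by simpa using hLl (y j) a a') hφb,
    abs_iInf_sub_iInf_le (fun a b b' => by simpa using hLr a b b') hψb,
    convexOn_mul_norm_sq_sub_iInf (fun j => hKl _ _) hφb,
    convexOn_mul_norm_sq_sub_iInf (fun a => hKr _ _) hψb,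
    fun a b => ?_, fun i => le_ciInf fun j => ?_, fun j => le_ciInf fun a => ?_⟩
  · linarith [ciInf_le (hψb b) a]
  · linarith [h₀ i j]
  · linarith [ciInf_le (hφb a) j]

end Semiconcave

/-! ### Second differences on a cube -/

section Lattice

variable {d : ℕ}

/-- The point of the lattice `δ ℤ^d` with index `k`. -/
def latticePoint (δ : ℝ) (k : Fin d → ℤ) : EuclideanSpace ℝ (Fin d) :=
  WithLp.toLp 2 fun a => δ * k a

theorem latticePoint_add (δ : ℝ) (k l : Fin d → ℤ) :
    latticePoint δ (k + l) = latticePoint δ k + latticePoint δ l := by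
  ext a
  simp [latticePoint, mul_add]

theorem latticePoint_sub (δ : ℝ) (k l : Fin d → ℤ) :
    latticePoint δ (k - l) = latticePoint δ k - latticePoint δ l := by
  ext a
  simp [latticePoint, mul_sub]

/-- The vertices of the unit cube. -/
def cubeVertices (d : ℕ) : Finset (Fin d → ℤ) := Fintype.piFinset fun _ => {0, 1}

theorem norm_sq_le_of_abs_le {δ : ℝ} {h : EuclideanSpace ℝ (Fin d)} (hh : ∀ a, |h a| ≤ δ) :
    ‖h‖ ^ 2 ≤ d * δ ^ 2 := by
  rw [EuclideanSpace.norm_sq_eq]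
  refine (Finset.sum_le_sum (g := fun _ => δ ^ 2) fun a _ => ?_).trans (by simp)
  exact pow_le_pow_left₀ (norm_nonneg _) (hh a) 2

theorem norm_sq_latticePoint_le {δ : ℝ} (hδ : 0 ≤ δ) {e : Fin d → ℤ} (he : e ∈ cubeVertices d) :
    ‖latticePoint δ e‖ ^ 2 ≤ d * δ ^ 2 := by
  refine norm_sq_le_of_abs_le fun a => ?_
  have := Fintype.mem_piFinset.1 he a
  simp only [Finset.mem_insert, Finset.mem_singleton] at this
  rcases this with h | h <;> simp [latticePoint, h, hδ, abs_of_nonneg]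

/-- The cube is a product of segments, and convex hulls commute with products. -/
theorem mem_convexHull_cubeVertices {δ : ℝ} (hδ : 0 ≤ δ) {h : EuclideanSpace ℝ (Fin d)}
    (hh : ∀ a, 0 ≤ h a ∧ h a ≤ δ) :
    h ∈ convexHull ℝ (latticePoint δ '' (cubeVertices d : Set (Fin d → ℤ))) := by
  have h1 : (WithLp.ofLp h : Fin d → ℝ) ∈ convexHull ℝ (Set.univ.pi fun _ => ({0, δ} : Set ℝ)) := by
    rw [convexHull_pi]
    intro a _
    rw [convexHull_pair, segment_eq_Icc hδ]
    exact hh a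
  have h2 := Set.mem_image_of_mem (WithLp.linearEquiv 2 ℝ (Fin d → ℝ)).symm.toLinearMap h1
  rw [LinearMap.image_convexHull] at h2
  refine convexHull_mono ?_ h2
  rintro _ ⟨w, hw, rfl⟩
  refine ⟨fun a => if w a = 0 then 0 else 1, ?_, ?_⟩
  · simp only [cubeVertices, Finset.mem_coe, Fintype.mem_piFinset]
    intro a
    split_ifs <;> simp
  · ext a
    have := hw a trivial
    simp only [Set.mem_insert_iff, Set.mem_singleton_iff] at this
    rcases this with h | h
    · simp [latticePoint, h]
    · by_cases hδ0 : δ = 0 <;> simp [latticePoint, h, hδ0]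

variable {φ : EuclideanSpace ℝ (Fin d) → ℝ} {K δ : ℝ}

theorem second_difference_le_of_semiconcave
    (hφ : ConvexOn ℝ Set.univ fun x => K * ‖x‖ ^ 2 - φ x) (x v : EuclideanSpace ℝ (Fin d)) :
    φ (x + v) + φ (x - v) - 2 * φ x ≤ 2 * K * ‖v‖ ^ 2 := by
  have h := hφ.2 (Set.mem_univ (x + v)) (Set.mem_univ (x - v)) 
    (show (0 : ℝ) ≤ 1 / 2 by norm_num) (show (0 : ℝ) ≤ 1 / 2 by norm_num) (by norm_num)
  have hx : (1 / 2 : ℝ) • (x + v) + (1 / 2 : ℝ) • (x - v) = x := by module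
  rw [hx] at h
  have := parallelogram_law_with_norm ℝ x v
  simp only [smul_eq_mul] at h
  have h' : K * ‖x + v‖ ^ 2 + K * ‖x - v‖ ^ 2 = 2 * (K * ‖x‖ ^ 2 + K * ‖v‖ ^ 2) := by
    rw [← mul_add, show ‖x + v‖ ^ 2 + ‖x - v‖ ^ 2 = 2 * (‖x‖ ^ 2 + ‖v‖ ^ 2) by linarith]
    ring
  linarith

/-- This sign allows one vertex to be bounded by the sum over all vertices, sums to be enlarged to
bigger boxes, and cell masses to be replaced by their upper bound. -/
theorem latticePoint_defect_nonneg (hK : 0 ≤ K) (hδ : 0 ≤ δ)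
    (hφ : ConvexOn ℝ Set.univ fun x => K * ‖x‖ ^ 2 - φ x) (x : EuclideanSpace ℝ (Fin d))
    {e : Fin d → ℤ} (he : e ∈ cubeVertices d) :
    0 ≤ 2 * K * (d * δ ^ 2) -
      (φ (x + latticePoint δ e) + φ (x - latticePoint δ e) - 2 * φ x) := by
  have h1 := second_difference_le_of_semiconcave hφ x (latticePoint δ e)
  have h2 := mul_le_mul_of_nonneg_left (norm_sq_latticePoint_le hδ he)
    (mul_nonneg zero_le_two hK)
  linarith

/-- The second differences of a semiconcave function along a cube are controlled by those along
the vertices of the cube. -/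
theorem neg_second_difference_le_sum_cubeVertices (hK : 0 ≤ K) (hδ : 0 ≤ δ)
    (hφ : ConvexOn ℝ Set.univ fun x => K * ‖x‖ ^ 2 - φ x) (x : EuclideanSpace ℝ (Fin d))
    {h : EuclideanSpace ℝ (Fin d)} (hh : ∀ a, 0 ≤ h a ∧ h a ≤ δ) :
    2 * φ x - φ (x + h) - φ (x - h) ≤ ∑ e ∈ cubeVertices d, (2 * K * (d * δ ^ 2) -
      (φ (x + latticePoint δ e) + φ (x - latticePoint δ e) - 2 * φ x)) := by
  set f : EuclideanSpace ℝ (Fin d) → ℝ := fun x => K * ‖x‖ ^ 2 - φ x with hf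
  -- This convex function of `v` is at most its value at some vertex `e` of the cube. As `e` depends
  -- on `h`, it is then replaced by the sum over all vertices.
  have hu : ConvexOn ℝ Set.univ fun v => f (x + v) + f (x - v) := by
    have h1 : ConvexOn ℝ Set.univ fun v => f (x + v) := by
      simpa [Function.comp_def] using hφ.translate_right x
    have h2 : ConvexOn ℝ Set.univ fun v => f (x - v) := by
      simpa [Function.comp_def, sub_eq_add_neg] using h1.comp_linearMap (-LinearMap.id)
    exact h1.add h2
  obtain ⟨_, ⟨e, he, rfl⟩, hle⟩ := hu.exists_ge_of_mem_convexHull (Set.subset_univ _)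
    (mem_convexHull_cubeVertices hδ hh)
  refine le_trans ?_ (Finset.single_le_sum (f := fun e => 2 * K * (d * δ ^ 2) -
      (φ (x + latticePoint δ e) + φ (x - latticePoint δ e) - 2 * φ x))
    (fun e he => latticePoint_defect_nonneg hK hδ hφ x he) he)
  have h1 := parallelogram_law_with_norm ℝ x h
  have h2 := parallelogram_law_with_norm ℝ x (latticePoint δ e)
  have h3 := mul_le_mul_of_nonneg_left (norm_sq_latticePoint_le hδ he)
    (mul_nonneg zero_le_two hK)
  have h4 : 0 ≤ K * ‖h‖ ^ 2 := by positivity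
  have h1' : ‖x + h‖ ^ 2 + ‖x - h‖ ^ 2 = 2 * (‖x‖ ^ 2 + ‖h‖ ^ 2) := by linarith
  have h2' : ‖x + latticePoint δ e‖ ^ 2 + ‖x - latticePoint δ e‖ ^ 2 =
    2 * (‖x‖ ^ 2 + ‖latticePoint δ e‖ ^ 2) := by linarith
  have h5 : K * ‖x + h‖ ^ 2 + K * ‖x - h‖ ^ 2 = 2 * (K * ‖x‖ ^ 2 + K * ‖h‖ ^ 2) := by
    rw [← mul_add, h1']
    ring
  have h6 : K * ‖x + latticePoint δ e‖ ^ 2 + K * ‖x - latticePoint δ e‖ ^ 2 =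
      2 * (K * ‖x‖ ^ 2 + K * ‖latticePoint δ e‖ ^ 2) := by
    rw [← mul_add, h2']
    ring
  simp only [hf] at hle
  linarith

end Lattice

/-! ### Summation by parts on the lattice -/

section LatticeBox

/-- The lattice points with all coordinates at most `N` in absolute value. -/
noncomputable def latticeBox (d N : ℕ) : Finset (Fin d → ℤ) := Finset.Icc (fun _ => -(N : ℤ)) fun _ => (N : ℤ)

variable {d : ℕ}

theorem mem_latticeBox {N : ℕ} {k : Fin d → ℤ} :
    k ∈ latticeBox d N ↔ ∀ a, -(N : ℤ) ≤ k a ∧ k a ≤ N := by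
  simp [latticeBox, Pi.le_def, forall_and]

theorem mem_latticeBox_iff_norm_le {N : ℕ} {k : Fin d → ℤ} : k ∈ latticeBox d N ↔ ‖k‖ ≤ N := by
  rw [mem_latticeBox, pi_norm_le_iff_of_nonneg (Nat.cast_nonneg N)]
  refine forall_congr' fun a => ?_
  rw [Int.norm_eq_abs, ← abs_le]
  norm_cast

theorem card_latticeBox (d N : ℕ) : (latticeBox d N).card = (2 * N + 1) ^ d := by
  rw [latticeBox, Pi.card_Icc]
  simp only [Int.card_Icc, Finset.prod_const, Finset.card_univ, Fintype.card_fin]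
  congr 1
  omega

theorem norm_le_one_of_mem_cubeVertices {e : Fin d → ℤ} (he : e ∈ cubeVertices d) : ‖e‖ ≤ 1 := by
  refine (pi_norm_le_iff_of_nonneg zero_le_one).2 fun a => ?_
  have := Fintype.mem_piFinset.1 he a
  simp only [Finset.mem_insert, Finset.mem_singleton] at this
  rcases this with h | h <;> simp [h]

/-- Summation by parts: the second differences of a discrete semiconcave Lipschitz function sum
over a box to at most a boundary term. -/
theorem mul_sum_latticeBox_le {F : (Fin d → ℤ) → ℝ} {e : Fin d → ℤ} (he : ‖e‖ ≤ 1)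
    {M₁ M₂ : ℝ} (hM₂ : 0 ≤ M₂) (h₂ : ∀ k, 0 ≤ M₂ - (F (k + e) + F (k - e) - 2 * F k))
    (h₁ : ∀ k, |F (k + e) - F k| ≤ M₁) (N : ℕ) :
    N * ∑ k ∈ latticeBox d N, (M₂ - (F (k + e) + F (k - e) - 2 * F k)) ≤
      (latticeBox d (2 * N + 1)).card * (2 * N * M₂ + M₁) := by
  -- Cone weight: at least `N` on the small box, 1-Lipschitz, zero off the box of radius `2 * N`.
  -- The extra 1 in `D` accommodates the shift by `e`.
  set w : (Fin d → ℤ) → ℝ := fun k => max 0 (2 * N - ‖k‖) with hw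
  set G : (Fin d → ℤ) → ℝ := fun k => F (k + e) - F k with hG
  set D := latticeBox d (2 * N + 1) with hD
  have hw0 : ∀ k, 0 ≤ w k := fun k => le_max_left _ _
  have hwN : ∀ k ∈ latticeBox d N, (N : ℝ) ≤ w k := fun k hk => by
    rw [mem_latticeBox_iff_norm_le] at hk
    exact le_max_of_le_right (by linarith)
  have hw2 : ∀ k, w k ≤ 2 * N := fun k => max_le (by positivity) (by linarith [norm_nonneg k])
  have hwlip : ∀ k, |w k - w (k + e)| ≤ 1 := fun k => by
    simp only [hw, max_comm (0 : ℝ)]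
    refine (abs_max_sub_max_le_abs _ _ _).trans ?_
    rw [show (2 * N - ‖k‖ - (2 * N - ‖k + e‖) : ℝ) = ‖k + e‖ - ‖k‖ by ring]
    refine (abs_norm_sub_norm_le _ _).trans ?_
    simpa using he
  have hwout : ∀ k ∉ D, w k = 0 := fun k hk => by
    rw [hD, mem_latticeBox_iff_norm_le, not_le] at hk
    push_cast at hk
    exact max_eq_left (by linarith)
  have hwoute : ∀ k ∉ D, w (k + e) = 0 := fun k hk => by
    rw [hD, mem_latticeBox_iff_norm_le, not_le] at hk
    push_cast at hk
    have := norm_sub_norm_le k (-e)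
    rw [norm_neg, sub_neg_eq_add] at this
    exact max_eq_left (by linarith)
  have hsub : latticeBox d N ⊆ D := fun k hk => by
    rw [mem_latticeBox_iff_norm_le] at hk
    rw [hD, mem_latticeBox_iff_norm_le]
    push_cast
    linarith [(Nat.cast_nonneg N : (0 : ℝ) ≤ N)]
  -- Both sums extend by zero to the whole lattice, where translation by `e` is a bijection.
  have hshift : ∑ k ∈ D, w k * G (k - e) = ∑ k ∈ D, w (k + e) * G k := by
    have h1 := tsum_eq_sum (L := .unconditional _) (f := fun k => w k * G (k - e)) (s := D)
      fun k hk => by rw [hwout k hk, zero_mul]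
    have h2 := tsum_eq_sum (L := .unconditional _) (f := fun k => w (k + e) * G k) (s := D)
      fun k hk => by rw [hwoute k hk, zero_mul]
    rw [← h1, ← h2, ← (Equiv.addRight e).tsum_eq fun k => w k * G (k - e)]
    simp
  calc N * ∑ k ∈ latticeBox d N, (M₂ - (F (k + e) + F (k - e) - 2 * F k))
      = ∑ k ∈ latticeBox d N, N * (M₂ - (F (k + e) + F (k - e) - 2 * F k)) := Finset.mul_sum _ _ _
    _ ≤ ∑ k ∈ latticeBox d N, w k * (M₂ - (F (k + e) + F (k - e) - 2 * F k)) :=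
        Finset.sum_le_sum fun k hk => mul_le_mul_of_nonneg_right (hwN k hk) (h₂ k)
    _ ≤ ∑ k ∈ D, w k * (M₂ - (F (k + e) + F (k - e) - 2 * F k)) :=
        Finset.sum_le_sum_of_subset_of_nonneg hsub fun k _ _ => mul_nonneg (hw0 k) (h₂ k)
    _ = ∑ k ∈ D, w k * M₂ - (∑ k ∈ D, w k * G k - ∑ k ∈ D, w k * G (k - e)) := by
        rw [← Finset.sum_sub_distrib, ← Finset.sum_sub_distrib]
        refine Finset.sum_congr rfl fun k _ => ?_
        simp only [hG, sub_add_cancel]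
        ring
    _ = ∑ k ∈ D, (w k * M₂ - (w k - w (k + e)) * G k) := by
        rw [hshift, ← Finset.sum_sub_distrib, ← Finset.sum_sub_distrib]
        refine Finset.sum_congr rfl fun k _ => ?_
        ring
    _ ≤ ∑ k ∈ D, (2 * N * M₂ + M₁) := by
        refine Finset.sum_le_sum fun k _ => ?_
        have h3 : |(w k - w (k + e)) * G k| ≤ 1 * M₁ := by
          rw [abs_mul]
          exact mul_le_mul (hwlip k) (h₁ k) (abs_nonneg _) zero_le_one
        have h4 := (abs_le.1 h3).1
        have h5 := mul_le_mul_of_nonneg_right (hw2 k) hM₂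
        linarith
    _ = _ := by rw [Finset.sum_const, nsmul_eq_mul]

end LatticeBox

/-! ### Grid cells and their masses -/

section Cells

variable {d : ℕ}

/-- The index of the cell of the grid of mesh `δ` containing a point, clamped to a box. -/
noncomputable def cellIndex (δ : ℝ) (N : ℕ) (x : EuclideanSpace ℝ (Fin d)) : latticeBox d N :=
  ⟨fun a => max (-(N : ℤ)) (min N ⌊x a / δ⌋), mem_latticeBox.2 fun a => by
    constructor <;> simp⟩

theorem measurable_cellIndex (δ : ℝ) (N : ℕ) :
    Measurable (cellIndex δ N : EuclideanSpace ℝ (Fin d) → latticeBox d N) := by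
  refine Measurable.subtype_mk (measurable_pi_lambda _ fun a => ?_)
  have : Measurable fun x : EuclideanSpace ℝ (Fin d) => ⌊x a / δ⌋ :=
    Int.measurable_floor.comp (by fun_prop)
  exact measurable_const.max (measurable_const.min this)

theorem sub_latticePoint_cellIndex_mem {δ : ℝ} (hδ : 0 < δ) {N : ℕ}
    {x : EuclideanSpace ℝ (Fin d)} (hx : ∀ a, |x a| ≤ N * δ) (a : Fin d) :
    0 ≤ (x - latticePoint δ (cellIndex δ N x : Fin d → ℤ)) a ∧
      (x - latticePoint δ (cellIndex δ N x : Fin d → ℤ)) a ≤ δ := by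
  have h1 := abs_le.1 (hx a)
  have hf1 : -(N : ℤ) ≤ ⌊x a / δ⌋ := by
    rw [Int.le_floor, le_div_iff₀ hδ]
    push_cast
    linarith
  have hf2 : ⌊x a / δ⌋ ≤ (N : ℤ) := by
    refine Int.floor_le_iff.2 ?_
    rw [div_lt_iff₀ hδ]
    push_cast
    linarith
  have hc : ((cellIndex δ N x : latticeBox d N) : Fin d → ℤ) a = ⌊x a / δ⌋ := by
    simp [cellIndex, hf1, hf2]
  have hl := Int.floor_le (x a / δ)
  have hu := (Int.lt_floor_add_one (x a / δ)).le
  rw [le_div_iff₀ hδ] at hl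
  rw [div_le_iff₀ hδ] at hu
  simp only [PiLp.sub_apply, latticePoint, hc]
  constructor <;> linarith

theorem volume_cell (δ : ℝ) (y : EuclideanSpace ℝ (Fin d)) :
    volume {x : EuclideanSpace ℝ (Fin d) | ∀ a, 0 ≤ (x - y) a ∧ (x - y) a ≤ δ} =
      ENNReal.ofReal δ ^ d := by
  have h := (EuclideanSpace.volume_preserving_symm_measurableEquiv_toLp (Fin d)).measure_preimage
    (s := Set.Icc (fun a => y a) fun a => y a + δ) measurableSet_Icc.nullMeasurableSet
  rw [Real.volume_Icc_pi] at h
  simp only [add_sub_cancel_left, Finset.prod_const, Finset.card_univ, Fintype.card_fin] at h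
  rw [← h]
  congr 1
  ext x
  simp [Pi.le_def, forall_and, add_comm]

theorem HasBoundedDensity.exists_measure_le {X : Type*} [MeasureSpace X] {μ : Measure X}
    [SFinite (volume : Measure X)] (h : HasBoundedDensity μ) :
    ∃ Λ : ℝ, 0 ≤ Λ ∧ ∀ s, μ s ≤ ENNReal.ofReal Λ * volume s := by
  obtain ⟨ρ, hρ, hρ0, rfl⟩ := h
  refine ⟨(eLpNorm ρ ∞ volume).toReal, ENNReal.toReal_nonneg, fun s => ?_⟩
  rw [ENNReal.ofReal_toReal hρ.2.ne, withDensity_apply', ← setLIntegral_const]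
  refine lintegral_mono_ae (ae_restrict_of_ae ?_)
  filter_upwards [ae_le_eLpNormEssSup (f := ρ) (μ := volume)] with x hx
  rw [eLpNorm_exponent_top]
  rwa [← ofReal_norm, Real.norm_of_nonneg (hρ0 x)] at hx

/-- Clamping makes the outer fibers unbounded, but by `hN` almost every point of a fiber lies in the
genuine cell, of volume `δ ^ d`. -/
theorem measureReal_cellIndex_fiber_le {μ : Measure (EuclideanSpace ℝ (Fin d))} {Λ : ℝ}
    (hΛ : 0 ≤ Λ) (hμ : ∀ s, μ s ≤ ENNReal.ofReal Λ * volume s) {δ : ℝ} (hδ : 0 < δ) {N : ℕ}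
    (hN : ∀ᵐ x ∂μ, ∀ a, |x a| ≤ N * δ) (k : latticeBox d N) :
    μ.real (cellIndex δ N ⁻¹' {k}) ≤ Λ * δ ^ d := by
  have h1 : μ (cellIndex δ N ⁻¹' {k}) ≤ μ {x : EuclideanSpace ℝ (Fin d) |
      ∀ a, 0 ≤ (x - latticePoint δ (k : Fin d → ℤ)) a ∧ (x - latticePoint δ (k : Fin d → ℤ)) a ≤ δ} := by
    refine measure_mono_ae ?_
    filter_upwards [hN] with x hx hxk a
    rw [← show cellIndex δ N x = k from hxk]
    exact sub_latticePoint_cellIndex_mem hδ hx a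
  have h2 := h1.trans (hμ _)
  rw [volume_cell, ← ENNReal.ofReal_pow hδ.le, ← ENNReal.ofReal_mul hΛ] at h2
  exact ENNReal.toReal_le_of_le_ofReal (by positivity) h2

end Cells

/-! ### Averaged gap estimate at scale √ε -/

theorem card_cubeVertices (d : ℕ) : (cubeVertices d).card = 2 ^ d := by
  simp [cubeVertices, Fintype.card_piFinset]

section Core

variable {d : ℕ}

/-- Averaged over the cells of a grid, with bounded density, the second differences of a Lipschitz
semiconcave function are quadratic in the mesh. -/
theorem sum_mul_cell_defect_le {φ : EuclideanSpace ℝ (Fin d) → ℝ} {K L Λ δ : ℝ} (hK : 0 ≤ K)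
    (hL : 0 ≤ L) (hΛ : 0 ≤ Λ) (hδ : 0 < δ)
    (hφ : ConvexOn ℝ Set.univ fun x => K * ‖x‖ ^ 2 - φ x)
    (hφL : ∀ x y, |φ x - φ y| ≤ L * ‖x - y‖) {N : ℕ} (hN : 1 ≤ N * δ)
    {m : latticeBox d N → ℝ} (hm : ∀ k, m k ≤ Λ * δ ^ d) :
    ∑ k : latticeBox d N, m k * ∑ e ∈ cubeVertices d, (2 * K * (d * δ ^ 2) -
      (φ (latticePoint δ (k : Fin d → ℤ) + latticePoint δ e) +
        φ (latticePoint δ (k : Fin d → ℤ) - latticePoint δ e) -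
        2 * φ (latticePoint δ (k : Fin d → ℤ)))) ≤
      Λ * (2 ^ d * ((4 * (N * δ) + 3 * δ) ^ d * ((4 * K * d + L * d) * δ ^ 2))) := by
  set A : (Fin d → ℤ) → (Fin d → ℤ) → ℝ := fun e k => 2 * K * (d * δ ^ 2) -
      (φ (latticePoint δ k + latticePoint δ e) + φ (latticePoint δ k - latticePoint δ e) -
        2 * φ (latticePoint δ k)) with hA
  have hA0 : ∀ e ∈ cubeVertices d, ∀ k, 0 ≤ A e k := fun e he k =>
    latticePoint_defect_nonneg hK hδ.le hφ _ he
  have hN0 : 0 < (N : ℝ) := by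
    by_contra! h
    have := mul_nonpos_of_nonpos_of_nonneg h hδ.le
    linarith
  have hsum : ∀ e ∈ cubeVertices d, ∑ k ∈ latticeBox d N, A e k ≤
      (4 * N + 3) ^ d * ((4 * K * d + L * d) * δ ^ 2) := by
    intro e he
    have hv : ‖latticePoint δ e‖ ≤ d * δ := by
      refine abs_le_of_sq_le_sq' ?_ (by positivity) |>.2
      refine (norm_sq_latticePoint_le hδ.le he).trans ?_
      rw [mul_pow]
      gcongr
      exact_mod_cast Nat.le_self_pow two_ne_zero d
    have h := mul_sum_latticeBox_le (F := fun k => φ (latticePoint δ k)) (e := e)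
      (M₁ := L * (d * δ)) (M₂ := 2 * K * (d * δ ^ 2)) (norm_le_one_of_mem_cubeVertices he)
      (by positivity) (fun k => by
        simp only [latticePoint_add, latticePoint_sub]
        exact hA0 e he k) (fun k => by
        refine (hφL _ _).trans ?_
        rw [latticePoint_add, add_sub_cancel_left]
        gcongr) N
    rw [card_latticeBox] at h
    simp only [latticePoint_add, latticePoint_sub] at h
    refine le_of_mul_le_mul_left (h.trans ?_) hN0
    -- The boundary term is only of order `δ`; `1 ≤ N * δ` trades it for `N` times a term of order
    -- `δ ^ 2`, and the factor `N` is then cancelled.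
    have h1 : L * (d * δ) ≤ L * (d * δ) * (N * δ) := le_mul_of_one_le_right (by positivity) hN
    calc ((((2 * (2 * N + 1) + 1) ^ d : ℕ) : ℝ)) * (2 * N * (2 * K * (d * δ ^ 2)) + L * (d * δ))
        ≤ (((2 * (2 * N + 1) + 1) ^ d : ℕ) : ℝ) *
          (2 * N * (2 * K * (d * δ ^ 2)) + L * (d * δ) * (N * δ)) := by gcongr
      _ = N * ((4 * N + 3) ^ d * ((4 * K * d + L * d) * δ ^ 2)) := by
        push_cast
        rw [show (2 * (2 * (N : ℝ) + 1) + 1) = 4 * N + 3 by ring]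
        ring
  calc ∑ k : latticeBox d N, m k * ∑ e ∈ cubeVertices d, A e k
      ≤ ∑ k : latticeBox d N, Λ * δ ^ d * ∑ e ∈ cubeVertices d, A e k :=
        Finset.sum_le_sum fun k _ => mul_le_mul_of_nonneg_right (hm k)
          (Finset.sum_nonneg fun e he => hA0 e he k)
    _ = Λ * δ ^ d * ∑ e ∈ cubeVertices d, ∑ k ∈ latticeBox d N, A e k := by
        rw [← Finset.mul_sum, Finset.sum_coe_sort (latticeBox d N)
          fun k => ∑ e ∈ cubeVertices d, A e k, Finset.sum_comm]
    _ ≤ Λ * δ ^ d * ∑ e ∈ cubeVertices d, (4 * N + 3) ^ d * ((4 * K * d + L * d) * δ ^ 2) := by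
        gcongr with e he
        exact hsum e he
    _ = _ := by
        rw [Finset.sum_const, card_cubeVertices, nsmul_eq_mul,
          show (4 * (N * δ) + 3 * δ) = (4 * N + 3) * δ by ring, mul_pow]
        push_cast
        ring

/-- Control of the duality gap near a point by its value there and by second differences. -/
theorem duality_gap_le {V : Type*} [NormedAddCommGroup V] [NormedSpace ℝ V]
    {c : V × V → ℝ} {ℓ : V × V → V × V →L[ℝ] ℝ} {K : ℝ}
    (hK : ∀ z h, |c (z + h) - c z - ℓ z h| ≤ K * ‖h‖ ^ 2) {φ ψ : V → ℝ}
    (hle : ∀ a b, φ a + ψ b ≤ c (a, b)) (x y h h' : V) :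
    c (x + h, y + h') - φ (x + h) - ψ (y + h') ≤ 2 * (c (x, y) - φ x - ψ y) +
      2 * K * ‖(h, h')‖ ^ 2 + (2 * φ x - φ (x + h) - φ (x - h)) +
      (2 * ψ y - ψ (y + h') - ψ (y - h')) := by
  -- Taylor at opposite increments cancels the linear part of `c`; the gap at the reflected point is
  -- dropped, being nonnegative.
  have h1 := (abs_le.1 (hK (x, y) (h, h'))).2
  have h2 := (abs_le.1 (hK (x, y) (-(h, h')))).2
  rw [norm_neg, map_neg, ← sub_eq_add_neg, Prod.mk_sub_mk] at h2
  rw [Prod.mk_add_mk] at h1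
  linarith [hle (x - h) (y - h')]

theorem integrable_of_lipschitz_of_ae_bounded {μ : Measure (EuclideanSpace ℝ (Fin d))}
    [IsFiniteMeasure μ] {φ : EuclideanSpace ℝ (Fin d) → ℝ} {L R : ℝ} (hL : 0 ≤ L)
    (hφL : ∀ x y, |φ x - φ y| ≤ L * ‖x - y‖) (hR : ∀ᵐ x ∂μ, ∀ a, |x a| ≤ R) :
    Integrable φ μ := by
  have hc : Continuous φ := (LipschitzWith.of_dist_le_mul (K := ⟨L, hL⟩) fun x y => by
    rw [Real.dist_eq, dist_eq_norm]
    exact hφL x y).continuous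
  refine Integrable.of_bound hc.aestronglyMeasurable (|φ 0| + L * Real.sqrt (d * R ^ 2)) ?_
  filter_upwards [hR] with x hx
  have h1 := hφL x 0
  rw [sub_zero] at h1
  have h2 := mul_le_mul_of_nonneg_left (Real.le_sqrt_of_sq_le (norm_sq_le_of_abs_le hx)) hL
  have h3 := abs_sub_abs_le_abs_sub (φ x) (φ 0)
  rw [Real.norm_eq_abs]
  linarith

/-- The block approximation at scale `√ε` of a discrete optimal plan: its cost exceeds a dual value
by `O(ε)`, and its entropy is at most `(d / 2) log (1 / ε) + O(1)`. -/
theorem exists_coupling_of_scale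
    {c : EuclideanSpace ℝ (Fin d) × EuclideanSpace ℝ (Fin d) → ℝ}
    {ℓ : EuclideanSpace ℝ (Fin d) × EuclideanSpace ℝ (Fin d) →
      EuclideanSpace ℝ (Fin d) × EuclideanSpace ℝ (Fin d) →L[ℝ] ℝ}
    {B L K : ℝ} (hL0 : 0 ≤ L) (hK0 : 0 ≤ K) (hc : Continuous c) (hB : ∀ z, |c z| ≤ B)
    (hL : ∀ z w, |c z - c w| ≤ L * ‖z - w‖)
    (hK : ∀ z h, |c (z + h) - c z - ℓ z h| ≤ K * ‖h‖ ^ 2)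
    {μ ν : Measure (EuclideanSpace ℝ (Fin d))} [IsProbabilityMeasure μ] [IsProbabilityMeasure ν]
    {Λ Λ' R : ℝ} (hΛ : 0 ≤ Λ) (hμ : ∀ s, μ s ≤ ENNReal.ofReal Λ * volume s)
    (hΛ' : 0 ≤ Λ') (hν : ∀ s, ν s ≤ ENNReal.ofReal Λ' * volume s) (hR1 : 1 ≤ R)
    (hμR : ∀ᵐ x ∂μ, ∀ a, |x a| ≤ R) (hνR : ∀ᵐ x ∂ν, ∀ a, |x a| ≤ R)
    {ε : ℝ} (hε : 0 < ε) (hε1 : ε < 1) :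
    ∃ (γ : Measure (EuclideanSpace ℝ (Fin d) × EuclideanSpace ℝ (Fin d)))
      (φ ψ : EuclideanSpace ℝ (Fin d) → ℝ), IsCoupling μ ν γ ∧ Integrable φ μ ∧ Integrable ψ ν ∧
      (∀ a b, φ a + ψ b ≤ c (a, b)) ∧
      InformationTheory.klDiv γ (μ.prod ν) ≤
        ENNReal.ofReal (d * Real.log (2 * R + 3) + d / 2 * Real.log (1 / ε)) ∧
      ∫ z, c z ∂γ ≤ ∫ x, φ x ∂μ + ∫ y, ψ y ∂ν + (2 + 2 * K * d +
        (Λ + Λ') * (2 ^ d * ((4 * R + 7) ^ d * (4 * K * d + L * d)))) * ε := by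
  set δ := Real.sqrt ε with hδd
  have hδ : 0 < δ := Real.sqrt_pos.2 hε
  have hδ1 : δ ≤ 1 := Real.sqrt_le_one.2 hε1.le
  have hδ2 : δ ^ 2 = ε := Real.sq_sqrt hε.le
  set N := ⌈R / δ⌉₊ with hN
  have hNR : R ≤ N * δ := by
    rw [← div_le_iff₀ hδ]
    exact Nat.le_ceil _
  have hNR' : N * δ ≤ R + 1 := by
    have h := (Nat.ceil_lt_add_one (show 0 ≤ R / δ by positivity)).le
    have := mul_le_mul_of_nonneg_right h hδ.le
    rw [add_mul, div_mul_cancel₀ _ hδ.ne'] at this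
    linarith
  have hN1 : 1 ≤ N * δ := hR1.trans hNR
  have hμN : ∀ᵐ x ∂μ, ∀ a, |x a| ≤ N * δ := hμR.mono fun x hx a => (hx a).trans hNR
  have hνN : ∀ᵐ x ∂ν, ∀ a, |x a| ≤ N * δ := hνR.mono fun x hx a => (hx a).trans hNR
  set κ : EuclideanSpace ℝ (Fin d) → latticeBox d N := cellIndex δ N with hκd
  have hκ : Measurable κ := measurable_cellIndex δ N
  have hne : Nonempty (latticeBox d N) := ⟨cellIndex δ N 0⟩
  set pt : latticeBox d N → EuclideanSpace ℝ (Fin d) :=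
    fun k => latticePoint δ (k : Fin d → ℤ) with hpt
  have hsum1 : ∀ (m : Measure (EuclideanSpace ℝ (Fin d))) [IsProbabilityMeasure m],
      ∑ k, m.real (κ ⁻¹' {k}) = 1 := fun m _ => by
    have := integral_comp_fintype m hκ fun _ => 1
    simpa using this.symm
  -- The duality gap allowed is `ε` itself; doubled by `duality_gap_le`, it gives the 2 in the final
  -- constant.
  obtain ⟨g, φ₀, ψ₀, hg0, hg1, hg2, hfeas, hgap⟩ := exists_finite_plan_potentials
    (a := fun k => μ.real (κ ⁻¹' {k})) (b := fun k => ν.real (κ ⁻¹' {k}))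
    (fun _ => measureReal_nonneg) (fun _ => measureReal_nonneg) (hsum1 μ) (hsum1 ν)
    (fun k l => c (pt k, pt l)) hε
  obtain ⟨γ, hγ, hcell, hent⟩ := exists_block_coupling μ ν hκ hκ hg0 hg1 hg2
  obtain ⟨φ, ψ, hφL, hψL, hφ, hψ, hle, hφ₀, hψ₀⟩ :=
    exists_semiconcave_potentials hB hL hK pt pt hfeas
  have hφi := integrable_of_lipschitz_of_ae_bounded hL0 hφL hμR
  have hψi := integrable_of_lipschitz_of_ae_bounded hL0 hψL hνR
  refine ⟨γ, φ, ψ, hγ, hφi, hψi, hle, hent.trans ?_, ?_⟩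
  · refine ENNReal.ofReal_le_ofReal ?_
    -- There are `(2 * N + 1) ^ d` cells, and `(2 * N + 1) * δ ≤ 2 * R + 3` because `N * δ ≤ R + 1`
    -- and `δ ≤ 1`.
    rw [Fintype.card_coe, card_latticeBox]
    push_cast
    rw [Real.log_pow, show (d : ℝ) * Real.log (2 * R + 3) + d / 2 * Real.log (1 / ε) =
      d * (Real.log (2 * R + 3) + Real.log (1 / ε) / 2) by ring,
      ← Real.log_sqrt (by positivity), ← Real.log_mul (by positivity) (by positivity)]
    gcongr
    rw [Real.sqrt_div zero_le_one, Real.sqrt_one, ← hδd, mul_one_div, le_div_iff₀ hδ]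
    linarith
  · have hprob := hγ.1
    have hdef : ∀ {χ : EuclideanSpace ℝ (Fin d) → ℝ} {m : Measure (EuclideanSpace ℝ (Fin d))}
        {Λ : ℝ}, 0 ≤ Λ → (∀ s, m s ≤ ENNReal.ofReal Λ * volume s) →
        (∀ᵐ x ∂m, ∀ a, |x a| ≤ N * δ) → (ConvexOn ℝ Set.univ fun x => K * ‖x‖ ^ 2 - χ x) →
        (∀ x y, |χ x - χ y| ≤ L * ‖x - y‖) →
        ∑ k : latticeBox d N, m.real (κ ⁻¹' {k}) * ∑ e ∈ cubeVertices d, (2 * K * (d * δ ^ 2) -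
          (χ (pt k + latticePoint δ e) + χ (pt k - latticePoint δ e) - 2 * χ (pt k))) ≤
        Λ * (2 ^ d * ((4 * R + 7) ^ d * (4 * K * d + L * d))) * ε := by
      intro χ m Λ h1 h2 h3 h4 h5
      refine (sum_mul_cell_defect_le hK0 hL0 h1 hδ h4 h5 hN1
        (measureReal_cellIndex_fiber_le h1 h2 hδ h3)).trans ?_
      rw [hδ2]
      have : 4 * (N * δ) + 3 * δ ≤ 4 * R + 7 := by linarith
      calc _ ≤ Λ * (2 ^ d * ((4 * R + 7) ^ d * ((4 * K * d + L * d) * ε))) := by gcongr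
        _ = _ := by ring
    set P : latticeBox d N → ℝ := fun k => ∑ e ∈ cubeVertices d, (2 * K * (d * δ ^ 2) -
      (φ (pt k + latticePoint δ e) + φ (pt k - latticePoint δ e) - 2 * φ (pt k))) with hP
    set Q : latticeBox d N → ℝ := fun k => ∑ e ∈ cubeVertices d, (2 * K * (d * δ ^ 2) -
      (ψ (pt k + latticePoint δ e) + ψ (pt k - latticePoint δ e) - 2 * ψ (pt k))) with hQ
    set S : latticeBox d N × latticeBox d N → ℝ :=
      fun p => c (pt p.1, pt p.2) - φ₀ p.1 - ψ₀ p.2 with hS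
    have hγ1 : ∀ {p : EuclideanSpace ℝ (Fin d) → Prop}, (∀ᵐ x ∂μ, p x) → ∀ᵐ z ∂γ, p z.1 :=
      fun h => ae_of_ae_map measurable_fst.aemeasurable (hγ.2.1.symm ▸ h)
    have hγ2 : ∀ {p : EuclideanSpace ℝ (Fin d) → Prop}, (∀ᵐ x ∂ν, p x) → ∀ᵐ z ∂γ, p z.2 :=
      fun h => ae_of_ae_map measurable_snd.aemeasurable (hγ.2.2.symm ▸ h)
    have hbound : ∀ᵐ z ∂γ, c z ≤ φ z.1 + ψ z.2 +
        (2 * S (Prod.map κ κ z) + 2 * K * d * ε + P (κ z.1) + Q (κ z.2)) := by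
      filter_upwards [hγ1 hμN, hγ2 hνN] with z hz1 hz2
      have hm1 := sub_latticePoint_cellIndex_mem hδ hz1
      have hm2 := sub_latticePoint_cellIndex_mem hδ hz2
      have hgp := duality_gap_le hK hle (pt (κ z.1)) (pt (κ z.2)) (z.1 - pt (κ z.1))
        (z.2 - pt (κ z.2))
      rw [add_sub_cancel, add_sub_cancel] at hgp
      have hp := neg_second_difference_le_sum_cubeVertices hK0 hδ.le hφ (pt (κ z.1)) hm1
      have hq := neg_second_difference_le_sum_cubeVertices hK0 hδ.le hψ (pt (κ z.2)) hm2
      have hnorm : ‖(z.1 - pt (κ z.1), z.2 - pt (κ z.2))‖ ^ 2 ≤ d * ε := by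
        have habs : ∀ {t : ℝ}, 0 ≤ t ∧ t ≤ δ → |t| ≤ δ := fun h => by rw [abs_of_nonneg h.1]; exact h.2
        rw [Prod.norm_mk, ← hδ2]
        rcases max_choice ‖z.1 - pt (κ z.1)‖ ‖z.2 - pt (κ z.2)‖ with h | h <;> rw [h]
        · exact norm_sq_le_of_abs_le fun a => habs (hm1 a)
        · exact norm_sq_le_of_abs_le fun a => habs (hm2 a)
      have hnorm' := mul_le_mul_of_nonneg_left hnorm (mul_nonneg zero_le_two hK0)
      -- Extension did not lower the potentials, so the gap at the corners is at most the discrete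
      -- gap `S`.
      have hs1 := hφ₀ (κ z.1)
      have hs2 := hψ₀ (κ z.2)
      rw [add_sub_cancel] at hp hq
      simp only [hP, hQ, hS, Prod.map_fst, Prod.map_snd]
      simp only [Prod.mk.eta] at hgp
      linarith
    have hci : Integrable c γ := Integrable.of_bound hc.aestronglyMeasurable B (ae_of_all _ hB)
    have hφγ : Integrable (fun z => φ z.1) γ :=
      (show Integrable φ (γ.map Prod.fst) by rwa [hγ.2.1]).comp_measurable measurable_fst
    have hψγ : Integrable (fun z => ψ z.2) γ :=
      (show Integrable ψ (γ.map Prod.snd) by rwa [hγ.2.2]).comp_measurable measurable_snd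
    have hfst : ∀ f : EuclideanSpace ℝ (Fin d) → ℝ, Integrable f μ →
        ∫ z, f z.1 ∂γ = ∫ x, f x ∂μ := fun f hf => by
      have := integral_map (μ := γ) measurable_fst.aemeasurable (f := f)
        (by rw [hγ.2.1]; exact hf.1)
      rw [hγ.2.1] at this
      exact this.symm
    have hsnd : ∀ f : EuclideanSpace ℝ (Fin d) → ℝ, Integrable f ν →
        ∫ z, f z.2 ∂γ = ∫ x, f x ∂ν := fun f hf => by
      have := integral_map (μ := γ) measurable_snd.aemeasurable (f := f)
        (by rw [hγ.2.2]; exact hf.1)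
      rw [hγ.2.2] at this
      exact this.symm
    have hSi : Integrable (fun z => 2 * S (Prod.map κ κ z)) γ :=
      (integrable_comp_of_finite γ (hκ.prodMap hκ) S).const_mul 2
    have hPi : Integrable (fun z => P (κ z.1)) γ :=
      integrable_comp_of_finite γ (hκ.comp measurable_fst) P
    have hQi : Integrable (fun z => Q (κ z.2)) γ :=
      integrable_comp_of_finite γ (hκ.comp measurable_snd) Q
    refine (integral_mono_ae hci ((hφγ.add hψγ).add
      (((hSi.add (integrable_const (2 * K * d * ε))).add hPi).add hQi)) hbound).trans ?_
    rw [integral_add' (hφγ.add hψγ) (((hSi.add (integrable_const _)).add hPi).add hQi),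
      integral_add' hφγ hψγ, integral_add' ((hSi.add (integrable_const _)).add hPi) hQi,
      integral_add' (hSi.add (integrable_const _)) hPi, integral_add' hSi (integrable_const _),
      integral_const_mul, integral_const, hfst φ hφi, hsnd ψ hψi,
      hfst (fun x => P (κ x)) (integrable_comp_of_finite μ hκ P),
      hsnd (fun x => Q (κ x)) (integrable_comp_of_finite ν hκ Q),
      integral_comp_fintype μ hκ P, integral_comp_fintype ν hκ Q,
      integral_comp_fintype γ (hκ.prodMap hκ) S]
    simp only [hcell, probReal_univ, one_smul]
    have h1 := hdef hΛ hμ hμN hφ hφL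
    have h2 := hdef hΛ' hν hνN hψ hψL
    linarith

end Core

/-! ### Weak duality and conclusion -/

theorem IsCoupling.ae_mem_prod {X Y : Type*} [MeasurableSpace X] [MeasurableSpace Y]
    {μ : Measure X} {ν : Measure Y} {γ : Measure (X × Y)} (hγ : IsCoupling μ ν γ)
    {S : Set X} {T : Set Y} (hS : ∀ᵐ x ∂μ, x ∈ S) (hT : ∀ᵐ y ∂ν, y ∈ T) :
    ∀ᵐ z ∂γ, z ∈ S ×ˢ T := by
  filter_upwards [ae_of_ae_map measurable_fst.aemeasurable (hγ.2.1.symm ▸ hS),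
    ae_of_ae_map measurable_snd.aemeasurable (hγ.2.2.symm ▸ hT)] with z h1 h2
  exact ⟨h1, h2⟩

/-- Weak duality: dual feasible potentials bound the cost of any coupling from below. -/
theorem IsCoupling.integral_add_integral_le {X Y : Type*} [MeasurableSpace X] [MeasurableSpace Y]
    {μ : Measure X} {ν : Measure Y} {γ : Measure (X × Y)} (hγ : IsCoupling μ ν γ)
    {c : X × Y → ℝ} (hc : Integrable c γ) {φ : X → ℝ} {ψ : Y → ℝ} (hφ : Integrable φ μ)
    (hψ : Integrable ψ ν) (hle : ∀ a b, φ a + ψ b ≤ c (a, b)) :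
    ∫ x, φ x ∂μ + ∫ y, ψ y ∂ν ≤ ∫ z, c z ∂γ := by
  obtain ⟨-, rfl, rfl⟩ := hγ
  have h1 : Integrable (fun z : X × Y => φ z.1) γ := hφ.comp_measurable measurable_fst
  have h2 : Integrable (fun z : X × Y => ψ z.2) γ := hψ.comp_measurable measurable_snd
  rw [integral_map measurable_fst.aemeasurable hφ.1, integral_map measurable_snd.aemeasurable hψ.1,
    ← integral_add h1 h2]
  exact integral_mono (h1.add h2) hc fun z => hle z.1 z.2

theorem exists_ae_abs_le_of_isCompact_support {d : ℕ} {μ : Measure (EuclideanSpace ℝ (Fin d))}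
    (hμ : IsCompact μ.support) : ∃ R, ∀ᵐ x ∂μ, ∀ a, |x a| ≤ R := by
  obtain ⟨R, hR⟩ := hμ.isBounded.exists_norm_le
  refine ⟨R, ?_⟩
  filter_upwards [Measure.support_mem_ae] with x hx a
  exact (PiLp.norm_apply_le x a).trans (hR x hx)

theorem mainTheorem5 (d : ℕ)
    (Ωm Ωp : Set (EuclideanSpace ℝ (Fin d)))
    (hΩm_open : IsOpen Ωm) (hΩm_conv : Convex ℝ Ωm)
    (hΩp_open : IsOpen Ωp) (hΩp_conv : Convex ℝ Ωp)
    (c : EuclideanSpace ℝ (Fin d) × EuclideanSpace ℝ (Fin d) → ℝ)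
    (hc : IsC11LocOn c (Ωm ×ˢ Ωp))
    (μm μp : Measure (EuclideanSpace ℝ (Fin d)))
    [IsProbabilityMeasure μm] [IsProbabilityMeasure μp]
    (hμm_dens : HasBoundedDensity μm) (hμp_dens : HasBoundedDensity μp)
    (hμm_supp : IsCompactlySupportedIn μm Ωm) (hμp_supp : IsCompactlySupportedIn μp Ωp) :
    ∃ M : ℝ, 0 ≤ M ∧ ∀ ε : ℝ, 0 < ε → ε < 1 →
      entropicCost c μm μp ε ≤
        transportCost c μm μp +
          (((d : ℝ) / 2 * ε * Real.log (1 / ε) + M * ε : ℝ) : EReal) := by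
  obtain ⟨c', ℓ, B, L, K, hL0, hK0, hc', heq, hB, hL, hK⟩ := hc.exists_global_extension
    (hΩm_open.prod hΩp_open) (hμm_supp.1.prod hμp_supp.1)
    (Set.prod_mono hμm_supp.2 hμp_supp.2)
  -- Every coupling is concentrated on the product of the supports, where the extended cost agrees
  -- with `c`.
  have hint : ∀ γ, IsCoupling μm μp γ → ∫ z, c z ∂γ = ∫ z, c' z ∂γ := fun γ hγ =>
    integral_congr_ae <| by
      filter_upwards [hγ.ae_mem_prod Measure.support_mem_ae Measure.support_mem_ae] with z hz
      exact (heq z hz).symm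
  obtain ⟨Λ, hΛ, hμ⟩ := hμm_dens.exists_measure_le
  obtain ⟨Λ', hΛ', hν⟩ := hμp_dens.exists_measure_le
  obtain ⟨R₁, hR₁⟩ := exists_ae_abs_le_of_isCompact_support hμm_supp.1
  obtain ⟨R₂, hR₂⟩ := exists_ae_abs_le_of_isCompact_support hμp_supp.1
  set R := max 1 (max R₁ R₂) with hR
  have hR1 : 1 ≤ R := le_max_left _ _
  have hR₁' : R₁ ≤ R := (le_max_left _ _).trans (le_max_right _ _)
  have hR₂' : R₂ ≤ R := (le_max_right _ _).trans (le_max_right _ _)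
  have hlogR : 0 ≤ Real.log (2 * R + 3) := Real.log_nonneg (by linarith)
  set M := 2 + 2 * K * d + (Λ + Λ') * (2 ^ d * ((4 * R + 7) ^ d * (4 * K * d + L * d))) with hM
  have hM0 : 0 ≤ M := by positivity
  refine ⟨M + d * Real.log (2 * R + 3), by positivity, fun ε hε hε1 => ?_⟩
  obtain ⟨γ, φ, ψ, hγ, hφ, hψ, hle, hent, hcost⟩ := exists_coupling_of_scale hL0 hK0 hc' hB hL hK
    hΛ hμ hΛ' hν hR1 (hR₁.mono fun x hx a => (hx a).trans hR₁')
    (hR₂.mono fun x hx a => (hx a).trans hR₂') hε hε1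
  -- The potentials depend on `ε`, but weak duality bounds their dual value by v₀ for each `ε`,
  -- while `M` does not depend on `ε`.
  have hlow : ((∫ x, φ x ∂μm + ∫ y, ψ y ∂μp : ℝ) : EReal) ≤ transportCost c μm μp :=
    le_iInf₂ fun γ' hγ' => by
      rw [EReal.coe_le_coe_iff, hint γ' hγ']
      have := hγ'.1
      exact hγ'.integral_add_integral_le
        (Integrable.of_bound hc'.aestronglyMeasurable B (ae_of_all _ hB)) hφ hψ hle
  set H := d * Real.log (2 * R + 3) + d / 2 * Real.log (1 / ε) with hH
  have hlog : 0 ≤ Real.log (1 / ε) := Real.log_nonneg (by rw [le_div_iff₀ hε]; linarith)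
  have hH0 : 0 ≤ H := by positivity
  have hentE : ((InformationTheory.klDiv γ (μm.prod μp) : ℝ≥0∞) : EReal) ≤ ((H : ℝ) : EReal) := by
    have := EReal.coe_ennreal_le_coe_ennreal_iff.2 hent
    rwa [EReal.coe_ennreal_ofReal, max_eq_left hH0] at this
  calc entropicCost c μm μp ε
      ≤ ((∫ z, c z ∂γ : ℝ) : EReal) +
        (ε : EReal) * ((InformationTheory.klDiv γ (μm.prod μp) : ℝ≥0∞) : EReal) := iInf₂_le γ hγ
    _ ≤ ((∫ x, φ x ∂μm + ∫ y, ψ y ∂μp + M * ε : ℝ) : EReal) + (ε : EReal) * (H : EReal) := by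
        refine add_le_add ?_ (mul_le_mul_of_nonneg_left hentE (EReal.coe_nonneg.2 hε.le))
        rw [EReal.coe_le_coe_iff, hint γ hγ]
        exact hcost
    _ = ((∫ x, φ x ∂μm + ∫ y, ψ y ∂μp : ℝ) : EReal) + (((d : ℝ) / 2 * ε * Real.log (1 / ε) +
          (M + d * Real.log (2 * R + 3)) * ε : ℝ) : EReal) := by
        rw [← EReal.coe_mul, ← EReal.coe_add, ← EReal.coe_add, EReal.coe_eq_coe_iff, hH]
        ring
    _ ≤ _ := add_le_add hlow le_rfl
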